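/- **$q$-Poisson–Serre relations.** Let $\mathfrak g$ be a finite-dimensional complex semisimple Lie algebra with Killing form $\kappa$, Cartan subalgebra $\mathfrak h$, root system $\Delta$ and simple roots $\alpha_1,\dots,\alpha_l$. Write $(\cdot,\cdot)$ for the bilinear form on $\mathfrak h^*$ induced by $\kappa$, and $A_{ij}=2(\alpha_i,\alpha_j)/(\alpha_i,\alpha_i)$ for the Cartan matrix. Let $(E_\alpha)_{\alpha\in\Delta}$ be root vectors with $\kappa(E_\alpha,E_\beta)=\delta_{\alpha,-\beta}$, and $(K_a)_a$ an orthonormal basis of $\mathfrak h$ with respect to $\kappa$. Let $\beta_1,\dots,\beta_N$ be an enumeration of the positive roots such that, whenever $i<j$ and $\beta_i+\beta_j$ is a root, $\beta_i+\beta_j=\beta_k$ for some $i<k<j$. Let $c\in\{1,\sqrt{-1}\}$, let $\gamma$ be a nonzero real number, and let $A_\alpha\in\mathbb C\setminus\{0\}$ ($\alpha\in\Delta$) be normalisation constants. Put $$R_{12}=c\sum_{\alpha>0}\bigl(E_\alpha\otimes E_{-\alpha}-E_{-\alpha}\otimes E_\alpha\bigr),\qquad H_{12}=c\sum_a K_a\otimes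 K_a .$$ Let $(\mathcal A,\{\cdot,\cdot\})$ be a commutative Poisson algebra over $\mathbb C$ (for example the complex-valued functions on a Poisson manifold), let $Q^E_\alpha\in\mathcal A$ ($\alpha\in\Delta$) be charges, and put $$M^{\pm}=\prod_{k=1}^N\exp\bigl(\pm\sqrt{-1}\,c\gamma A_{\pm\beta_k}Q^E_{\pm\beta_k}E_{\pm\beta_k}\bigr),$$ the product being taken in increasing order of $k$ and evaluated in a faithful finite-dimensional matrix representation of $\mathfrak g$. For a sign $\pm$, consider the relation $$\{M^\pm_1,M^\pm_2\}=\gamma\Bigl([R_{12},M^\pm_1M^\pm_2]\mp M^\pm_1H_{12}M^\pm_2\pm M^\pm_2H_{12}M^\pm_1\Bigr),\tag{PBMM}$$ where $X_1=X\otimes 1$, $X_2=1\otimes X$, and $\{M_1,M_2\}$ is the tensor of the Poisson brackets of the matrix entries. For elements $f,g\in\mathcal A$ of weights $\mu,\nu\in\mathfrak h^*$ define $$\{f,g\}_q=\{f,g\}+c\gamma\,(\mu,\nu)\,fg,\qquad \{f,g\}_{q^{-1}}=\{f,g\}-c\gamma\,(\mu,\nu)\,fg,$$ where $Q^E_\alpha$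 has weight $\alpha$, and the (deformed) bracket of elements of weights $\mu$ and $\nu$ has weight $\mu+\nu$. Then the following hold. 1. If $M^+$ satisfies (PBMM) (upper signs), then for all $i\neq j$ $$\bigl\{\bigl\{\dots\bigl\{Q^E_{\alpha_j},\underbrace{Q^E_{\alpha_i}\bigr\}_q,\dots,Q^E_{\alpha_i}\bigr\}_q,Q^E_{\alpha_i}}_{1-A_{ij}\ \text{times}}\bigr\}_q=0 \quad\text{and}\quad \bigl\{\underbrace{Q^E_{\alpha_i},\bigl\{Q^E_{\alpha_i},\dots,\bigl\{Q^E_{\alpha_i}}_{1-A_{ij}\ \text{times}},Q^E_{\alpha_j}\bigr\}_q\dots\bigr\}_q\bigr\}_q=0 .$$ 2. If $M^-$ satisfies (PBMM) (lower signs), then for all $i\neq j$ the same two relations hold with $Q^E_{-\alpha_i},Q^E_{-\alpha_j}$ in place of $Q^E_{\alpha_i},Q^E_{\alpha_j}$ and $\{\cdot,\cdot\}_{q^{-1}}$ in place of $\{\cdot,\cdot\}_q$. -/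

import Mathlib

open scoped Kronecker
open LieAlgebra LieAlgebra.IsKilling LieModule Module

attribute [local instance 100] LieRing.ofAssociativeRing

namespace QPoissonSerre

/-- A Poisson bracket on a commutative complex algebra `𝒜`, for example on the algebra of
complex-valued functions on a Poisson manifold. -/
structure PoissonBracket (𝒜 : Type*) [CommRing 𝒜] [Algebra ℂ 𝒜] where
  /-- the underlying `ℂ`-bilinear map `(f, g) ↦ {f, g}` -/
  bracket : 𝒜 →ₗ[ℂ] 𝒜 →ₗ[ℂ] 𝒜
  skew : ∀ f g, bracket f g = -bracket g f
  leibniz : ∀ f g h, bracket f (g * h) = bracket f g * h + g * bracket f h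
  jacobi : ∀ f g h, bracket f (bracket g h) + bracket g (bracket h f)
    + bracket h (bracket f g) = 0

section Tensor

variable {n 𝒜 : Type*} [CommRing 𝒜] [Algebra ℂ 𝒜]

/-- The exponential of a nilpotent element of a complex algebra (a finite sum). -/
noncomputable def nilExp {B : Type*} [Ring B] [Algebra ℂ B] (a : B) : B :=
  letI : Module ℚ B := Module.compHom B (algebraMap ℚ ℂ)
  IsNilpotent.exp a

/-- A complex matrix regarded as a constant matrix with entries in `𝒜`. -/
def const (𝒜 : Type*) [CommRing 𝒜] [Algebra ℂ 𝒜] {m : Type*} (X : Matrix m m ℂ) :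
    Matrix m m 𝒜 :=
  X.map (algebraMap ℂ 𝒜)

/-- `{X₁, Y₂}`: the matrix whose entry at `((a, b), (a', b'))` is `{X a a', Y b b'}`. -/
def tensorBracket (P : PoissonBracket 𝒜) (X Y : Matrix n n 𝒜) : Matrix (n × n) (n × n) 𝒜 :=
  Matrix.kroneckerMap (fun f g => P.bracket f g) X Y

variable [DecidableEq n]

/-- `X₁ = X ⊗ 1`. -/
def leg₁ (X : Matrix n n 𝒜) : Matrix (n × n) (n × n) 𝒜 := X ⊗ₖ (1 : Matrix n n 𝒜)

/-- `X₂ = 1 ⊗ X`. -/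
def leg₂ (X : Matrix n n 𝒜) : Matrix (n × n) (n × n) 𝒜 := (1 : Matrix n n 𝒜) ⊗ₖ X

end Tensor

section Lie

variable {𝔤 : Type*} [LieRing 𝔤] [LieAlgebra ℂ 𝔤] [FiniteDimensional ℂ 𝔤] [IsSemisimple ℂ 𝔤]
variable {H : LieSubalgebra ℂ 𝔤} [H.IsCartanSubalgebra]

/-- The bilinear form on `𝔥*` obtained from the Killing form through the isomorphism
`𝔥 ≃ 𝔥*` that it induces. -/
noncomputable def dualForm (μ ν : Dual ℂ H) : ℂ :=
  killingForm ℂ 𝔤 ((cartanEquivDual H).symm μ : H) ((cartanEquivDual H).symm ν : H)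

/-- `E α` is a root vector for every root `α`, and `κ(E α, E β) = δ_{α, -β}`.
The values of `E` at weights that are not roots (that is, at zero) are irrelevant. -/
structure IsCartanWeyl (E : Weight ℂ H 𝔤 → 𝔤) : Prop where
  mem : ∀ α ∈ H.root, E α ∈ rootSpace H α
  killing_neg : ∀ α ∈ H.root, killingForm ℂ 𝔤 (E α) (E (-α)) = 1
  killing_ne : ∀ α ∈ H.root, ∀ β ∈ H.root, α ≠ -β → killingForm ℂ 𝔤 (E α) (E β) = 0

/-- A labelling of the positive roots by `0, …, N - 1`. -/
abbrev PosLabelling (b : (rootSystem H).Base) (N : ℕ) :=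
  Fin N ≃ {α : H.root // b.IsPos α}

/-- The `k`-th positive root. -/
def PosLabelling.root {b : (rootSystem H).Base} {N : ℕ} (β : PosLabelling b N) (k : Fin N) :
    Weight ℂ H 𝔤 :=
  (β k).1.1

/-- If `i < j` and `β_i + β_j` is a root, then `β_i + β_j = β_k` for some `k` with
`i < k < j`. -/
def PosLabelling.IsConvex {b : (rootSystem H).Base} {N : ℕ} (β : PosLabelling b N) : Prop :=
  ∀ i j : Fin N, i < j → ∀ δ ∈ H.root,
    (δ.toLinear : Dual ℂ H) = (β.root i).toLinear + (β.root j).toLinear →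
      ∃ k : Fin N, i < k ∧ k < j ∧ β.root k = δ

variable {b : (rootSystem H).Base} {N : ℕ}
variable {n : Type*} [Fintype n] [DecidableEq n] {𝒜 : Type*} [CommRing 𝒜] [Algebra ℂ 𝒜]

/-- `M⁺ = ∏ₖ exp (i c γ A_{βₖ} Q_{βₖ} E_{βₖ})`, in the order of the labelling and in the
representation `ρ`. -/
noncomputable def mPlus (c γ : ℂ) (E : Weight ℂ H 𝔤 → 𝔤) (A : Weight ℂ H 𝔤 → ℂ)
    (β : PosLabelling b N) (ρ : 𝔤 →ₗ⁅ℂ⁆ Matrix n n ℂ) (Q : Weight ℂ H 𝔤 → 𝒜) :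
    Matrix n n 𝒜 :=
  (List.ofFn fun k : Fin N =>
    nilExp (((Complex.I * c * γ * A (β.root k)) • Q (β.root k)) •
      const 𝒜 (ρ (E (β.root k))))).prod

/-- `M⁻ = ∏ₖ exp (-i c γ A_{-βₖ} Q_{-βₖ} E_{-βₖ})`, in the order of the labelling and in the
representation `ρ`. -/
noncomputable def mMinus (c γ : ℂ) (E : Weight ℂ H 𝔤 → 𝔤) (A : Weight ℂ H 𝔤 → ℂ)
    (β : PosLabelling b N) (ρ : 𝔤 →ₗ⁅ℂ⁆ Matrix n n ℂ) (Q : Weight ℂ H 𝔤 → 𝒜) :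
    Matrix n n 𝒜 :=
  (List.ofFn fun k : Fin N =>
    nilExp (((-(Complex.I * c * γ * A (-β.root k))) • Q (-β.root k)) •
      const 𝒜 (ρ (E (-β.root k))))).prod

/-- `R₁₂ = c ∑_{α > 0} (E_α ⊗ E_{-α} - E_{-α} ⊗ E_α)`, the kernel of the standard `R`-matrix
`c (π_{𝔫₊} - π_{𝔫₋})` with respect to the Killing form, in the representation `ρ ⊗ ρ`. -/
noncomputable def rTensor (c : ℂ) (E : Weight ℂ H 𝔤 → 𝔤) (β : PosLabelling b N)
    (ρ : 𝔤 →ₗ⁅ℂ⁆ Matrix n n ℂ) : Matrix (n × n) (n × n) ℂ :=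
  c • ∑ k : Fin N,
    (ρ (E (β.root k)) ⊗ₖ ρ (E (-β.root k)) - ρ (E (-β.root k)) ⊗ₖ ρ (E (β.root k)))

/-- `H₁₂ = c ∑_a K_a ⊗ K_a` in the representation `ρ ⊗ ρ`. -/
noncomputable def hTensor {ι : Type*} [Fintype ι] (c : ℂ) (K : ι → H)
    (ρ : 𝔤 →ₗ⁅ℂ⁆ Matrix n n ℂ) : Matrix (n × n) (n × n) ℂ :=
  c • ∑ a, ρ (K a : 𝔤) ⊗ₖ ρ (K a : 𝔤)

/-- The relation
`{M₁, M₂} = γ ([R₁₂, M₁ M₂] - s M₁ H₁₂ M₂ + s M₂ H₁₂ M₁)`,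
with `s = 1` for `M⁺` and `s = -1` for `M⁻`. -/
def BracketRelation (P : PoissonBracket 𝒜) (γ s : ℂ) (R₁₂ H₁₂ : Matrix (n × n) (n × n) ℂ)
    (M : Matrix n n 𝒜) : Prop :=
  tensorBracket P M M =
    γ • ((const 𝒜 R₁₂ * (leg₁ M * leg₂ M) - (leg₁ M * leg₂ M) * const 𝒜 R₁₂)
      - s • (leg₁ M * const 𝒜 H₁₂ * leg₂ M)
      + s • (leg₂ M * const 𝒜 H₁₂ * leg₁ M))

/-- The deformed bracket `{f, g} + t (μ, ν) f g` of an element `f` of weight `μ` and an element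
`g` of weight `ν`. It is the `q`-bracket for `t = c γ` and the `q⁻¹`-bracket for `t = -c γ`. -/
noncomputable def qBracket (P : PoissonBracket 𝒜) (t : ℂ) (μ ν : Dual ℂ H) (f g : 𝒜) : 𝒜 :=
  P.bracket f g + (t * dualForm μ ν) • (f * g)

/-- `{…{{g, f}, f}, …, f}` with `r` nested deformed brackets, for `f` of weight `μ` and `g` of
weight `ν`; the intermediate bracket of depth `r` has weight `ν + r μ`. -/
noncomputable def nestedRight (P : PoissonBracket 𝒜) (t : ℂ) (μ ν : Dual ℂ H) (f g : 𝒜) :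
    ℕ → 𝒜
  | 0 => g
  | r + 1 => qBracket P t (ν + r • μ) μ (nestedRight P t μ ν f g r) f

/-- `{f, …, {f, {f, g}}…}` with `r` nested deformed brackets, for `f` of weight `μ` and `g` of
weight `ν`; the intermediate bracket of depth `r` has weight `ν + r μ`. -/
noncomputable def nestedLeft (P : PoissonBracket 𝒜) (t : ℂ) (μ ν : Dual ℂ H) (f g : 𝒜) :
    ℕ → 𝒜
  | 0 => g
  | r + 1 => qBracket P t μ (ν + r • μ) f (nestedLeft P t μ ν f g r)

/-- The number `1 - A_ij`, where `A_ij = α_j(α_i^∨)`; it is positive for distinct simple roots. -/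
noncomputable def serreDepth (i j : H.root) : ℕ :=
  (1 - (rootSystem H).pairingIn ℤ j i).toNat

end Lie

end QPoissonSerre

set_option linter.unusedSectionVars false

/-! Write `M = ∏ exp (x_k E_{δ k})`, where the `δ k` list one root from each pair `±α` and `x_k` is
the charge times a nonzero scalar. Fix simple `δ p`, `δ q`; put `x = x_p`, `e = E_{δ p}`, `f = E_{-δ
p}`, `h = [e, f]` and `κ = cγ`.

The Casimir tensor commutes with `M ⊗ M`, so in the bracket relation the half of `R₁₂` built from
`E_{-δ} ⊗ E_δ` can be traded for the other half and the Cartan part. Pairing the first leg with a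
trace functional dual to `e` leaves (`map_bracket_of_bracketRelation`) `{x, M} = κ (2 [f, M] + x (hM
+ Mh))`. The anticommutator disappears once the factor `exp (x e)` is cancelled: `x` Poisson
commutes with `exp (-x e)`, and an `sl₂` computation (`linearise_right`, `linearise_left`) gives
`{x, Z} = κ (2 [f, Z] ± x [h, Z])` for `Z = M exp (-x e)`, respectively `Z = exp (-x e) M`.

Let `ψ` be the trace functional dual to `E_{δ q}`, so that `ψ Z = x_q`. On a functional of definite
weight the `h`-term is a scalar multiple of `x`, and it is exactly what the `q`-correction cancels.
Hence the `r`-fold deformed bracket is `(±2κ)^r ψ ((ad f)^r Z)` (`nestedLeft_eq`, `nestedRight_eq`),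
and `ψ ∘ (ad f)^r` sees only the part of `Z` of weight `δ q + r δ p`.

Grade by the element of `𝔥` that is `0` on `δ p` and `1` on the other simple roots of the chosen
sign. Without the factor `exp (x e)`, `Z` is `1` plus root vectors of degree one plus terms of
degree at least two (`factor_mem_unipotentMod`). The weight `δ q + r δ p` has degree one, and for `r
= 1 - A_ij` it is not a root, so the bracket vanishes. The statement for `M⁻` is the same one for
the roots `-β_k` with `γ` replaced by `-γ`. -/

namespace QPoissonSerre

/-! ### Exponentials of nilpotent elements and conjugation by them. -/

section NilExp

variable {B : Type*} [Ring B] [Algebra ℂ B]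

theorem nilExp_eq_sum {a : B} {k : ℕ} (h : a ^ k = 0) :
    nilExp a = ∑ i ∈ Finset.range k, ((i.factorial : ℂ)⁻¹) • a ^ i := by
  let _ : Module ℚ B := Module.compHom B (algebraMap ℚ ℂ)
  refine (IsNilpotent.exp_eq_sum h).trans (Finset.sum_congr rfl fun i _ => ?_)
  change (algebraMap ℚ ℂ ((i.factorial : ℚ)⁻¹)) • a ^ i = _
  simp

theorem nilExp_mul_nilExp_neg {a : B} (h : IsNilpotent a) : nilExp a * nilExp (-a) = 1 := by
  let _ : Module ℚ B := Module.compHom B (algebraMap ℚ ℂ)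
  exact IsNilpotent.exp_mul_exp_neg_self h

theorem nilExp_neg_mul_nilExp {a : B} (h : IsNilpotent a) : nilExp (-a) * nilExp a = 1 := by
  let _ : Module ℚ B := Module.compHom B (algebraMap ℚ ℂ)
  exact IsNilpotent.exp_neg_mul_exp_self h

theorem nilExp_add {a b : B} (hab : Commute a b) (ha : IsNilpotent a) (hb : IsNilpotent b) :
    nilExp (a + b) = nilExp a * nilExp b := by
  let _ : Module ℚ B := Module.compHom B (algebraMap ℚ ℂ)
  exact IsNilpotent.exp_add_of_commute hab ha hb

theorem map_nilExp {B' : Type*} [Ring B'] [Algebra ℂ B'] {a : B} (h : IsNilpotent a)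
    (f : B →+* B') : f (nilExp a) = nilExp (f a) := by
  let _ : Module ℚ B := Module.compHom B (algebraMap ℚ ℂ)
  let _ : Module ℚ B' := Module.compHom B' (algebraMap ℚ ℂ)
  exact IsNilpotent.map_exp h f

theorem nilExp_mem {S : Subalgebra ℂ B} {a : B} (h : IsNilpotent a) (ha : a ∈ S) :
    nilExp a ∈ S := by
  obtain ⟨k, hk⟩ := h
  rw [nilExp_eq_sum hk]
  exact S.sum_mem fun i _ => S.smul_mem (S.pow_mem ha i) _

theorem commute_nilExp {a y : B} (h : IsNilpotent a) (hy : Commute y a) :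
    Commute y (nilExp a) := by
  obtain ⟨k, hk⟩ := h
  rw [nilExp_eq_sum hk]
  exact Commute.sum_right _ _ _ fun i _ => (hy.pow_right i).smul_right _

/-- `exp a * y * exp (-a) = ∑ᵢ (ad a)ⁱ y / i!`. -/
theorem nilExp_conj {a : B} (h : IsNilpotent a) (y : B) {k : ℕ} (hk : (ad ℂ B a ^ k) y = 0) :
    nilExp a * y * nilExp (-a) =
      ∑ i ∈ Finset.range k, ((i.factorial : ℂ)⁻¹) • (ad ℂ B a ^ i) y := by
  have hL : nilExp (LinearMap.mulLeft ℂ a) = LinearMap.mulLeft ℂ (nilExp a) :=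
    (map_nilExp h (Algebra.lmul ℂ B).toRingHom).symm
  have hR : nilExp (LinearMap.mulRight ℂ (-a)) = LinearMap.mulRight ℂ (nilExp (-a)) := by
    obtain ⟨m, hm⟩ := h.neg
    rw [nilExp_eq_sum hm, nilExp_eq_sum (k := m) (by rw [LinearMap.pow_mulRight, hm]; simp)]
    ext z
    simp [LinearMap.pow_mulRight, Finset.mul_sum]
  have hnL : IsNilpotent (LinearMap.mulLeft ℂ a) := by
    simpa [LinearMap.isNilpotent_mulLeft_iff] using h
  have hnR : IsNilpotent (LinearMap.mulRight ℂ (-a)) := by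
    simpa [LinearMap.isNilpotent_mulRight_iff] using h
  have had : ad ℂ B a = LinearMap.mulLeft ℂ a + LinearMap.mulRight ℂ (-a) := by
    ext z; simp [LieRing.of_associative_ring_bracket, sub_eq_add_neg]
  have hc : Commute (LinearMap.mulLeft ℂ a) (LinearMap.mulRight ℂ (-a)) :=
    LinearMap.commute_mulLeft_right _ _
  have key := nilExp_add hc hnL hnR
  rw [← had, hL, hR] at key
  have hnad : IsNilpotent (ad ℂ B a) := had ▸ hc.isNilpotent_add hnL hnR
  have h1 : nilExp a * y * nilExp (-a) = nilExp (ad ℂ B a) y := by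
    rw [key]; simp [mul_assoc]
  obtain ⟨m, hm⟩ := hnad
  -- The nilpotency index `m` of `ad a` is unrelated to `k`. The exponent `k + m` lets the sum split
  -- into its first `k` terms and a tail that kills `y`.
  have hm' : (ad ℂ B a) ^ (k + m) = 0 := by rw [pow_add, hm, mul_zero]
  rw [h1, nilExp_eq_sum hm', Finset.sum_range_add]
  simp only [LinearMap.add_apply, LinearMap.sum_apply, LinearMap.smul_apply, add_eq_left]
  refine Finset.sum_eq_zero fun i _ => ?_
  rw [add_comm k i, pow_add, Module.End.mul_apply, hk, map_zero, smul_zero]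

theorem nilExp_conj_mem {a : B} (h : IsNilpotent a) (Y : Submodule ℂ B)
    (hY : ∀ y ∈ Y, a * y - y * a ∈ Y) {y : B} (hy : y ∈ Y) :
    nilExp a * y * nilExp (-a) ∈ Y := by
  obtain ⟨m, hm⟩ := LieAlgebra.ad_nilpotent_of_nilpotent (R := ℂ) h
  rw [nilExp_conj h y (k := m) (by rw [hm]; rfl)]
  have key : ∀ i, (ad ℂ B a ^ i) y ∈ Y := fun i => by
    induction i with
    | zero => simpa using hy
    | succ i ih => rw [pow_succ', Module.End.mul_apply]; exact hY _ ih
  exact Y.sum_mem fun i _ => Y.smul_mem _ (key i)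

end NilExp

/-! ### Filtration by degree, and unipotent elements modulo degree two. -/

section Filtration

variable {𝒜 B : Type*} [CommRing 𝒜] [Ring B] [Algebra ℂ B] [Algebra 𝒜 B]

/-- The span of the elements of integral degree at least `m` with respect to the inner
derivation `X ↦ D X - X D`. -/
def degGE (𝒜 : Type*) {B : Type*} [CommRing 𝒜] [Ring B] [Algebra ℂ B] [Algebra 𝒜 B]
    (D : B) (m : ℕ) : Submodule 𝒜 B :=
  Submodule.span 𝒜 {X | ∃ k : ℕ, m ≤ k ∧ D * X - X * D = (k : ℂ) • X}

variable {D : B}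

theorem mem_degGE {X : B} {k m : ℕ} (hm : m ≤ k) (h : D * X - X * D = (k : ℂ) • X) :
    X ∈ degGE 𝒜 D m :=
  Submodule.subset_span ⟨k, hm, h⟩

theorem degGE_anti {m k : ℕ} (h : m ≤ k) : degGE 𝒜 D k ≤ degGE 𝒜 D m :=
  Submodule.span_mono fun _ ⟨l, hl, e⟩ => ⟨l, h.trans hl, e⟩

theorem one_mem_degGE : (1 : B) ∈ degGE 𝒜 D 0 :=
  mem_degGE (k := 0) le_rfl (by simp)

theorem mul_mem_degGE {m k : ℕ} {X Y : B} (hX : X ∈ degGE 𝒜 D m) (hY : Y ∈ degGE 𝒜 D k) :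
    X * Y ∈ degGE 𝒜 D (m + k) := by
  have : degGE 𝒜 D m * degGE 𝒜 D k ≤ degGE 𝒜 D (m + k) := by
    rw [degGE, degGE, Submodule.span_mul_span, Submodule.span_le]
    rintro _ ⟨X, ⟨i, hi, hX⟩, Y, ⟨j, hj, hY⟩, rfl⟩
    refine mem_degGE (k := i + j) (by omega) ?_
    have : D * (X * Y) - X * Y * D = (D * X - X * D) * Y + X * (D * Y - Y * D) := by noncomm_ring
    rw [this, hX, hY]
    push_cast
    rw [smul_mul_assoc, mul_smul_comm, add_smul]
  exact this (Submodule.mul_mem_mul hX hY)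

theorem mul_mem_degGE_two {X Y : B} (hX : X ∈ degGE 𝒜 D 1) (hY : Y ∈ degGE 𝒜 D 1) :
    X * Y ∈ degGE 𝒜 D 2 := by
  simpa only [one_add_one_eq_two] using mul_mem_degGE hX hY

theorem pow_mem_degGE {m : ℕ} {X : B} (hX : X ∈ degGE 𝒜 D m) (k : ℕ) :
    X ^ k ∈ degGE 𝒜 D (k * m) := by
  induction k with
  | zero => simpa using one_mem_degGE
  | succ k ih => rw [pow_succ, Nat.succ_mul]; exact mul_mem_degGE ih hX

variable [Algebra ℂ 𝒜] [IsScalarTower ℂ 𝒜 B]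

theorem nilExp_mem_degGE_zero {a : B} (h : IsNilpotent a) (ha : a ∈ degGE 𝒜 D 0) :
    nilExp a ∈ degGE 𝒜 D 0 := by
  obtain ⟨k, hk⟩ := h
  rw [nilExp_eq_sum hk]
  exact Submodule.sum_mem _ fun i _ => Submodule.smul_of_tower_mem _ _ (pow_mem_degGE ha i)

theorem nilExp_sub_one_sub_mem_degGE {a : B} (h : IsNilpotent a) (ha : a ∈ degGE 𝒜 D 1) :
    nilExp a - 1 - a ∈ degGE 𝒜 D 2 := by
  obtain ⟨k, hk⟩ := h
  have hk' : a ^ (2 + k) = 0 := by rw [pow_add, hk, mul_zero]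
  rw [nilExp_eq_sum hk', Finset.sum_range_add]
  simp only [Finset.sum_range_succ, Finset.sum_range_zero, Nat.factorial]
  have : ∀ S : B, (0 + ((1 : ℕ) : ℂ)⁻¹ • a ^ 0 + (((0 + 1) * 1 : ℕ) : ℂ)⁻¹ • a ^ 1 + S) - 1 - a
      = S := by
    intro S; simp; abel
  rw [this]
  exact Submodule.sum_mem _ fun i _ => Submodule.smul_of_tower_mem _ _
    (degGE_anti (by omega) (pow_mem_degGE ha (2 + i)))

theorem nilExp_sub_one_mem_degGE {a : B} (h : IsNilpotent a) (ha : a ∈ degGE 𝒜 D 2) :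
    nilExp a - 1 ∈ degGE 𝒜 D 2 := by
  have := add_mem (nilExp_sub_one_sub_mem_degGE h (degGE_anti one_le_two ha)) ha
  simpa using this

/-- All cross terms have degree at least two, so the order of the factors is invisible in degree
one. This is how simple-root coordinates are read off from an ordered product. -/
theorem prod_nilExp_sub_mem_degGE (l : List B)
    (hl : ∀ a ∈ l, IsNilpotent a ∧ a ∈ degGE 𝒜 D 1) :
    (l.map nilExp).prod - 1 - l.sum ∈ degGE 𝒜 D 2 := by
  induction l with
  | nil => simp
  | cons a l ih =>
    have ih := ih fun b hb => hl b (List.mem_cons_of_mem _ hb)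
    obtain ⟨hn, ha⟩ := hl a List.mem_cons_self
    have hs : l.sum ∈ degGE 𝒜 D 1 :=
      list_sum_mem fun b hb => (hl b (List.mem_cons_of_mem _ hb)).2
    have he := nilExp_sub_one_sub_mem_degGE hn ha
    have he1 : nilExp a - 1 ∈ degGE 𝒜 D 1 := by
      simpa using add_mem (degGE_anti one_le_two he) ha
    have hp1 : (l.map nilExp).prod - 1 ∈ degGE 𝒜 D 1 := by
      simpa using add_mem (degGE_anti one_le_two ih) hs
    have : ((a :: l).map nilExp).prod - 1 - (a :: l).sum =
        (nilExp a - 1) * ((l.map nilExp).prod - 1) + (nilExp a - 1 - a) +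
          ((l.map nilExp).prod - 1 - l.sum) := by
      simp only [List.map_cons, List.prod_cons, List.sum_cons]; noncomm_ring
    rw [this]
    exact add_mem (add_mem (mul_mem_degGE_two he1 hp1) he) ih

/-- The elements congruent to `1` modulo `Y` and elements of degree at least two. -/
def unipotentMod (Y : Submodule 𝒜 B) (D : B) : Set B :=
  {X | X - 1 ∈ Y ⊔ degGE 𝒜 D 2}

variable {Y : Submodule 𝒜 B}

theorem mul_mem_unipotentMod (hY : Y ≤ degGE 𝒜 D 1) {X Z : B} (hX : X ∈ unipotentMod Y D)
    (hZ : Z ∈ unipotentMod Y D) : X * Z ∈ unipotentMod Y D := by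
  have hle : Y ⊔ degGE 𝒜 D 2 ≤ degGE 𝒜 D 1 := sup_le hY (degGE_anti one_le_two)
  have : X * Z - 1 = (X - 1) * (Z - 1) + ((X - 1) + (Z - 1)) := by noncomm_ring
  rw [unipotentMod, Set.mem_ofPred_eq, this]
  have h2 : (X - 1) * (Z - 1) ∈ degGE 𝒜 D 2 := mul_mem_degGE_two (hle hX) (hle hZ)
  exact add_mem (Submodule.mem_sup_right h2) (add_mem hX hZ)

theorem prod_mem_unipotentMod (hY : Y ≤ degGE 𝒜 D 1) (l : List B)
    (hl : ∀ X ∈ l, X ∈ unipotentMod Y D) : l.prod ∈ unipotentMod Y D := by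
  induction l with
  | nil =>
    change (1 : B) - 1 ∈ Y ⊔ degGE 𝒜 D 2
    rw [sub_self]
    exact zero_mem _
  | cons a l ih =>
    rw [List.prod_cons]
    exact mul_mem_unipotentMod hY (hl a List.mem_cons_self)
      (ih fun X hX => hl X (List.mem_cons_of_mem _ hX))

/-- Conjugation by a degree-zero exponential fixes `1`, preserves degree at least two, and preserves
`Y` because it is a polynomial in `ad a`. -/
theorem conj_mem_unipotentMod {a : B} (h : IsNilpotent a) (ha : a ∈ degGE 𝒜 D 0)
    (hY : ∀ y ∈ Y, a * y - y * a ∈ Y) {X : B} (hX : X ∈ unipotentMod Y D) :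
    nilExp a * X * nilExp (-a) ∈ unipotentMod Y D := by
  have e0 := nilExp_mem_degGE_zero h ha
  have e1 := nilExp_mem_degGE_zero h.neg (neg_mem ha)
  obtain ⟨y, hy, z, hz, hyz⟩ := Submodule.mem_sup.mp hX
  have : nilExp a * X * nilExp (-a) - 1 =
      nilExp a * y * nilExp (-a) + nilExp a * z * nilExp (-a) := by
    rw [← add_mul, ← mul_add, hyz, mul_sub, sub_mul, mul_one, nilExp_mul_nilExp_neg h]
  rw [unipotentMod, Set.mem_ofPred_eq, this]
  refine Submodule.add_mem_sup (nilExp_conj_mem h (Y.restrictScalars ℂ) hY hy) ?_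
  simpa using mul_mem_degGE (mul_mem_degGE e0 hz) e1

end Filtration

/-! ### Trace form of a faithful representation, dual bases and the Casimir tensor. -/

section Lie

variable {𝔤 : Type*} [LieRing 𝔤] [LieAlgebra ℂ 𝔤] [FiniteDimensional ℂ 𝔤] [IsSemisimple ℂ 𝔤]
variable {H : LieSubalgebra ℂ 𝔤} [H.IsCartanSubalgebra]

/-- If the pairing vanished, `t = [e, f]` would satisfy `tr t² = 0`. The weights of `V` take values
on `t` that are rational multiples of `α t`, so a sum of rational squares vanishes and `t` acts
nilpotently. But `e` is an eigenvector of `ad t` with eigenvalue `α t ≠ 0`, which faithfulness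
forbids. -/
theorem traceForm_ne_zero_of_killingForm_eq_one {V : Type*} [AddCommGroup V] [Module ℂ V]
    [FiniteDimensional ℂ V] [LieRingModule 𝔤 V] [LieModule ℂ 𝔤 V]
    (hV : Function.Injective (toEnd ℂ 𝔤 V)) {α : Weight ℂ H 𝔤} (hα : α.IsNonZero) {e f : 𝔤}
    (he : e ∈ rootSpace H α) (hf : f ∈ rootSpace H (-α)) (hef : killingForm ℂ 𝔤 e f = 1) :
    traceForm ℂ 𝔤 V e f ≠ 0 := by
  intro h0
  set t : H := (cartanEquivDual H).symm α with ht
  have het : ⁅e, f⁆ = (t : 𝔤) := by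
    rw [lie_eq_killingForm_smul_of_mem_rootSpace_of_mem_rootSpace_neg he hf, hef, one_smul]
  have hαt : α t ≠ 0 := root_apply_cartanEquivDual_symm_ne_zero hα
  have hte : ⁅(t : 𝔤), e⁆ = α t • e := lie_eq_smul_of_mem_rootSpace he t
  have htf : ⁅(t : 𝔤), f⁆ = -α t • f := by
    simpa using lie_eq_smul_of_mem_rootSpace hf t
  have htt : traceForm ℂ H V t t = 0 := by
    change traceForm ℂ 𝔤 V (t : 𝔤) (t : 𝔤) = 0
    nth_rw 1 [← het]
    -- Invariance moves one `t` onto `f`, which it scales, leaving a multiple of the pairing of `e`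
    -- with `f`.
    rw [traceForm_apply_lie_apply, ← lie_skew, htf]
    simp [h0]
  have htc : t ∈ corootSpace (α : H → ℂ) := cartanEquivDual_symm_apply_mem_corootSpace α
  -- Some integral combination of `α` and `χ`, with nonzero coefficient at `χ`, vanishes on the
  -- coroot space, which contains `t`.
  have hq : ∀ χ : Weight ℂ H V, ∃ q : ℚ, χ t = q * α t := fun χ => by
    obtain ⟨a, b, hb, h⟩ := exists_forall_mem_corootSpace_smul_add_eq_zero V (α : H → ℂ) χ
      hα χ.genWeightSpace_ne_bot
    have h := h t htc
    rw [Pi.add_apply, Pi.smul_apply, Pi.smul_apply, zsmul_eq_mul, zsmul_eq_mul] at h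
    have hb' : (b : ℂ) ≠ 0 := by exact_mod_cast hb.ne'
    refine ⟨-a / b, ?_⟩
    push_cast
    field_simp
    linear_combination h
  choose q hq using hq
  rw [traceForm_eq_sum_finrank_nsmul_mul] at htt
  have hsum : ((∑ χ : Weight ℂ H V, (finrank ℂ (genWeightSpace V χ) : ℚ) * q χ ^ 2 : ℚ) : ℂ)
      * α t ^ 2 = 0 := by
    rw [← htt]
    push_cast
    rw [Finset.sum_mul]
    refine Finset.sum_congr rfl fun χ _ => ?_
    rw [hq χ, nsmul_eq_mul]
    ring
  have hsum' : (∑ χ : Weight ℂ H V, (finrank ℂ (genWeightSpace V χ) : ℚ) * q χ ^ 2 : ℚ) = 0 := by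
    have := (mul_eq_zero.mp hsum).resolve_right (pow_ne_zero 2 hαt)
    exact_mod_cast this
  have hχ : ∀ χ : Weight ℂ H V, χ t = 0 := fun χ => by
    have := (Finset.sum_eq_zero_iff_of_nonneg fun _ _ => by positivity).mp hsum' χ
      (Finset.mem_univ _)
    have hpos : (finrank ℂ (genWeightSpace V χ) : ℚ) ≠ 0 := by
      have : Nontrivial (genWeightSpace V χ) :=
        LieSubmodule.nontrivial_iff_ne_bot ℂ H V |>.mpr χ.genWeightSpace_ne_bot
      exact_mod_cast (finrank_pos (R := ℂ) (M := genWeightSpace V χ)).ne'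
    rw [hq χ]
    simp [pow_eq_zero_iff two_ne_zero |>.mp ((mul_eq_zero.mp this).resolve_left hpos)]
  have hnil : _root_.IsNilpotent (toEnd ℂ 𝔤 V t) := by
    refine Module.End.isNilpotent_iff_of_finite.mpr fun m ↦ ?_
    have hm : m ∈ ⨆ χ : LieModule.Weight ℂ H V, genWeightSpace V χ := by
      simp [iSup_genWeightSpace_eq_top' ℂ H V]
    induction hm using LieSubmodule.iSup_induction' with
    | zero => exact ⟨0, map_zero _⟩
    | mem χ m hm =>
      obtain ⟨k, hk⟩ := (mem_genWeightSpace V χ m).mp hm t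
      rw [hχ χ, zero_smul, sub_zero] at hk
      exact ⟨k, hk⟩
    | add m₁ m₂ _ _ h₁ h₂ =>
      obtain ⟨n₁, hn₁⟩ := h₁
      obtain ⟨n₂, hn₂⟩ := h₂
      refine ⟨max n₁ n₂, ?_⟩
      rw [map_add, Module.End.pow_map_zero_of_le le_sup_left hn₁,
        Module.End.pow_map_zero_of_le le_sup_right hn₂, add_zero]
  obtain ⟨k, hk⟩ := LieAlgebra.ad_nilpotent_of_nilpotent (R := ℂ) hnil
  have hpow : ∀ k : ℕ, (ad ℂ (End ℂ V) (toEnd ℂ 𝔤 V t) ^ k) (toEnd ℂ 𝔤 V e) =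
      α t ^ k • toEnd ℂ 𝔤 V e := fun k => by
    induction k with
    | zero => simp
    | succ k ih =>
      rw [pow_succ', Module.End.mul_apply, ih, map_smul, ad_apply, ← LieHom.map_lie, hte,
        map_smul, smul_smul, pow_succ]
  have h1 := hpow k
  rw [hk, LinearMap.zero_apply, eq_comm, smul_eq_zero] at h1
  have he0 : e = 0 := hV ((h1.resolve_left (pow_ne_zero k hαt)).trans (map_zero _).symm)
  simp [he0] at hef

variable {n : Type*} [Fintype n] [DecidableEq n]

section Rep

variable (ρ : 𝔤 →ₗ⁅ℂ⁆ Matrix n n ℂ)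

/-- This number normalises the trace functional against `E_{-α}` so that it takes the value `1` on
`E_α`. -/
theorem trace_mul_ne_zero (hρ : Function.Injective ρ) {α : Weight ℂ H 𝔤} (hα : α.IsNonZero)
    {e f : 𝔤} (he : e ∈ rootSpace H α) (hf : f ∈ rootSpace H (-α))
    (hef : killingForm ℂ 𝔤 e f = 1) : (ρ e * ρ f).trace ≠ 0 := by
  let σ : 𝔤 →ₗ⁅ℂ⁆ End ℂ (n → ℂ) := (lieEquivMatrix' (R := ℂ) (n := n)).symm.toLieHom.comp ρ
  let _ : LieRingModule 𝔤 (n → ℂ) := LieRingModule.compLieHom (n → ℂ) σ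
  have : LieModule ℂ 𝔤 (n → ℂ) := LieModule.compLieHom (n → ℂ) σ
  have hσ : toEnd ℂ 𝔤 (n → ℂ) = σ := by ext; rfl
  have := traceForm_ne_zero_of_killingForm_eq_one (V := n → ℂ) (by
    rw [hσ]; exact lieEquivMatrix'.symm.injective.comp hρ) hα he hf hef
  rw [traceForm_apply_apply, hσ] at this
  intro h
  apply this
  have : σ e ∘ₗ σ f = Matrix.toLin' (ρ e * ρ f) := by
    rw [Matrix.toLin'_mul]; rfl
  rw [this, Matrix.trace_toLin'_eq, h]

theorem isNilpotent_map_of_mem_rootSpace {α : H → ℂ} (hα : α ≠ 0) {e : 𝔤}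
    (he : e ∈ rootSpace H α) : IsNilpotent (ρ e) := by
  let σ : 𝔤 →ₗ⁅ℂ⁆ End ℂ (n → ℂ) := (lieEquivMatrix' (R := ℂ) (n := n)).symm.toLieHom.comp ρ
  let _ : LieRingModule 𝔤 (n → ℂ) := LieRingModule.compLieHom (n → ℂ) σ
  have : LieModule ℂ 𝔤 (n → ℂ) := LieModule.compLieHom (n → ℂ) σ
  have h : IsNilpotent (Matrix.toLin' (ρ e)) :=
    isNilpotent_toEnd_of_mem_rootSpace (M := n → ℂ) H hα he
  exact (IsNilpotent.map_iff (f := Matrix.toLinAlgEquiv') Matrix.toLinAlgEquiv'.injective).mp h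

end Rep

/-- A family which lists exactly one of the roots `α`, `-α` for every root `α`. -/
structure IsHalfSystem {N : ℕ} (δ : Fin N → Weight ℂ H 𝔤) : Prop where
  mem : ∀ k, δ k ∈ H.root
  injective : Function.Injective δ
  ne_neg : ∀ k m, δ k ≠ -δ m
  exhaust : ∀ α ∈ H.root, ∃ k, α = δ k ∨ α = -δ k

theorem neg_mem_root {α : Weight ℂ H 𝔤} (h : α ∈ H.root) : -α ∈ H.root := by
  simpa using h

theorem isNonZero_of_mem_root {α : Weight ℂ H 𝔤} (h : α ∈ H.root) : α.IsNonZero := by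
  simpa using h

theorem exists_eq_smul_of_mem_rootSpace {E : Weight ℂ H 𝔤 → 𝔤} (hE : IsCartanWeyl E)
    {α : Weight ℂ H 𝔤} (hα : α ∈ H.root) {X : 𝔤} (hX : X ∈ rootSpace H α) :
    ∃ t : ℂ, X = t • E α := by
  have h1 := finrank_rootSpace_eq_one α (isNonZero_of_mem_root hα)
  have hne : (⟨E α, hE.mem α hα⟩ : rootSpace H α) ≠ 0 := by
    intro h
    have h0 : E α = 0 := congrArg Subtype.val h
    have := hE.killing_neg α hα
    simp [h0] at this
  obtain ⟨t, ht⟩ := (finrank_eq_one_iff_of_nonzero' _ hne).mp h1 ⟨X, hX⟩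
  exact ⟨t, (congrArg Subtype.val ht).symm⟩

section Casimir

variable {N : ℕ} {δ : Fin N → Weight ℂ H 𝔤} {E : Weight ℂ H 𝔤 → 𝔤}
  {ι : Type*} [Fintype ι] [DecidableEq ι] {K : Basis ι ℂ H}

theorem killingForm_root_cartan (hE : IsCartanWeyl E) {α : Weight ℂ H 𝔤} (hα : α ∈ H.root)
    (h : H) : killingForm ℂ 𝔤 (E α) h = 0 := by
  refine killingForm_apply_eq_zero_of_mem_rootSpace_of_add_ne_zero ℂ 𝔤 H (hE.mem α hα)
    (β := 0) ?_ (by simpa using isNonZero_of_mem_root hα)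
  simp

theorem eq_sum_killingForm (hδ : IsHalfSystem δ) (hE : IsCartanWeyl E)
    (hK : ∀ a a' : ι, killingForm ℂ 𝔤 (K a) (K a') = if a = a' then 1 else 0) (X : 𝔤) :
    X = ∑ k, killingForm ℂ 𝔤 (E (-δ k)) X • E (δ k) +
      ∑ k, killingForm ℂ 𝔤 (E (δ k)) X • E (-δ k) +
      ∑ a, killingForm ℂ 𝔤 (K a) X • (K a : 𝔤) := by
  have hm := hδ.mem
  have hm' := fun k => neg_mem_root (hδ.mem k)
  have hX : X ∈ ⨆ χ : Weight ℂ H 𝔤, genWeightSpace 𝔤 χ := by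
    simp [iSup_genWeightSpace_eq_top' ℂ H 𝔤]
  induction hX using LieSubmodule.iSup_induction' with
  | zero => simp
  | add X Y _ _ hX hY =>
    conv_lhs => rw [hX, hY]
    simp only [map_add, add_smul, Finset.sum_add_distrib]
    abel
  | mem χ X hX =>
    by_cases hχ : χ ∈ H.root
    · have hKE : ∀ a, killingForm ℂ 𝔤 (K a) (E χ) = 0 := fun a => by
        rw [traceForm_comm]; exact killingForm_root_cartan hE hχ _
      obtain ⟨t, rfl⟩ := exists_eq_smul_of_mem_rootSpace hE hχ hX
      obtain ⟨m, rfl | rfl⟩ := hδ.exhaust χ hχ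
      · have h1 : ∀ k, killingForm ℂ 𝔤 (E (-δ k)) (E (δ m)) = if k = m then 1 else 0 := fun k => by
          split_ifs with h
          · subst h; rw [traceForm_comm]; exact hE.killing_neg _ (hm k)
          · refine hE.killing_ne _ (hm' k) _ (hm m) fun h' => h (hδ.injective ?_)
            simpa using h'
        have h2 : ∀ k, killingForm ℂ 𝔤 (E (δ k)) (E (δ m)) = 0 := fun k =>
          hE.killing_ne _ (hm k) _ (hm m) (hδ.ne_neg k m)
        simp [h1, h2, hKE]
      · have h1 : ∀ k, killingForm ℂ 𝔤 (E (δ k)) (E (-δ m)) = if k = m then 1 else 0 := fun k => by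
          split_ifs with h
          · subst h; exact hE.killing_neg _ (hm k)
          · refine hE.killing_ne _ (hm k) _ (hm' m) fun h' => h (hδ.injective ?_)
            simpa using h'
        have h2 : ∀ k, killingForm ℂ 𝔤 (E (-δ k)) (E (-δ m)) = 0 := fun k =>
          hE.killing_ne _ (hm' k) _ (hm' m) (by simpa using (hδ.ne_neg m k).symm)
        simp [h1, h2, hKE]
    · have hz : (χ : H → ℂ) = 0 := by
        have : χ.IsZero := by simpa using hχ
        exact this.eq
      rw [hz] at hX
      have hXH : X ∈ H := by simpa using hX
      have hsum : X = ∑ a, K.repr ⟨X, hXH⟩ a • (K a : 𝔤) := by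
        have h : ((∑ a, K.repr ⟨X, hXH⟩ a • K a : H) : 𝔤) = ∑ a, K.repr ⟨X, hXH⟩ a • (K a : 𝔤) := by
          simp [-Basis.sum_repr]
        rwa [K.sum_repr] at h
      have h1 : ∀ α ∈ H.root, killingForm ℂ 𝔤 (E α) X = 0 := fun α hα =>
        killingForm_root_cartan hE hα ⟨X, hXH⟩
      have h2 : ∀ a, killingForm ℂ 𝔤 (K a) X = K.repr ⟨X, hXH⟩ a := fun a => by
        conv_lhs => rw [hsum]
        simp [hK]
      simp only [h1 _ (hm _), h1 _ (hm' _), zero_smul, Finset.sum_const_zero, zero_add, h2]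
      exact hsum

/-- Expanding `[X, u a]` in one family and using invariance of the Killing form shifts the bracket
to the other slot with the opposite sign. -/
theorem sum_lie_dual_families_eq_zero {κ W : Type*} [Fintype κ] [AddCommGroup W] [Module ℂ W]
    (u v : κ → 𝔤) (hu : ∀ X, X = ∑ a, killingForm ℂ 𝔤 (v a) X • u a)
    (hv : ∀ X, X = ∑ a, killingForm ℂ 𝔤 (u a) X • v a) (T : 𝔤 →ₗ[ℂ] 𝔤 →ₗ[ℂ] W) (X : 𝔤) :
    ∑ a, (T ⁅X, u a⁆ (v a) + T (u a) ⁅X, v a⁆) = 0 := by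
  have h1 : ∑ a, T ⁅X, u a⁆ (v a) = ∑ b, T (u b) ⁅v b, X⁆ := by
    calc ∑ a, T ⁅X, u a⁆ (v a)
        = ∑ a, ∑ b, killingForm ℂ 𝔤 (u a) ⁅v b, X⁆ • T (u b) (v a) := by
          refine Finset.sum_congr rfl fun a _ => ?_
          conv_lhs => rw [hu ⁅X, u a⁆]
          simp only [map_sum, LinearMap.sum_apply, map_smul, LinearMap.smul_apply]
          refine Finset.sum_congr rfl fun b _ => ?_
          rw [traceForm_comm ℂ 𝔤 𝔤 (u a), traceForm_apply_lie_apply]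
      _ = ∑ b, T (u b) ⁅v b, X⁆ := by
          rw [Finset.sum_comm]
          refine Finset.sum_congr rfl fun b _ => ?_
          conv_rhs => rw [hv ⁅v b, X⁆]
          simp only [map_sum, map_smul]
  rw [Finset.sum_add_distrib, h1, ← Finset.sum_add_distrib]
  refine Finset.sum_eq_zero fun a _ => ?_
  rw [← map_add, ← lie_skew, neg_add_cancel, map_zero]

/-- The Casimir tensor is invariant. -/
theorem casimir_invariant (hδ : IsHalfSystem δ) (hE : IsCartanWeyl E)
    (hK : ∀ a a' : ι, killingForm ℂ 𝔤 (K a) (K a') = if a = a' then 1 else 0)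
    {W : Type*} [AddCommGroup W] [Module ℂ W] (T : 𝔤 →ₗ[ℂ] 𝔤 →ₗ[ℂ] W) (X : 𝔤) :
    ∑ k, (T ⁅X, E (δ k)⁆ (E (-δ k)) + T (E (δ k)) ⁅X, E (-δ k)⁆) +
      ∑ k, (T ⁅X, E (-δ k)⁆ (E (δ k)) + T (E (-δ k)) ⁅X, E (δ k)⁆) +
      ∑ a, (T ⁅X, (K a : 𝔤)⁆ (K a) + T (K a) ⁅X, (K a : 𝔤)⁆) = 0 := by
  have := sum_lie_dual_families_eq_zero
    (Sum.elim (Sum.elim (fun k => E (δ k)) fun k => E (-δ k)) fun a => (K a : 𝔤))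
    (Sum.elim (Sum.elim (fun k => E (-δ k)) fun k => E (δ k)) fun a => (K a : 𝔤))
    (fun X => by simpa using eq_sum_killingForm hδ hE hK X)
    (fun X => by
      rw [Fintype.sum_sum_type, Fintype.sum_sum_type]
      simpa [add_comm] using eq_sum_killingForm hδ hE hK X) T X
  simpa using this

end Casimir

/-- The vector of the Cartan subalgebra which represents `μ` through the Killing form. -/
theorem sum_apply_smul_eq {ι : Type*} [Fintype ι] [DecidableEq ι] (K : Basis ι ℂ H)
    (hK : ∀ a a' : ι, killingForm ℂ 𝔤 (K a) (K a') = if a = a' then 1 else 0) (μ : Dual ℂ H) :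
    ∑ a, μ (K a) • K a = (cartanEquivDual H).symm μ := by
  rw [LinearEquiv.eq_symm_apply]
  refine K.ext fun a => ?_
  rw [cartanEquivDual_apply_apply]
  change killingForm ℂ 𝔤 ((∑ a, μ (K a) • K a : H) : 𝔤) (K a : 𝔤) = _
  simp [hK]

theorem dualForm_eq_apply (μ ν : Dual ℂ H) : dualForm μ ν = ν ((cartanEquivDual H).symm μ) := by
  conv_rhs => rw [← LinearEquiv.apply_symm_apply (cartanEquivDual H) ν]
  rw [cartanEquivDual_apply_apply]
  exact traceForm_comm ℂ 𝔤 𝔤 _ _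

theorem dualForm_comm (μ ν : Dual ℂ H) : dualForm μ ν = dualForm ν μ :=
  traceForm_comm ℂ 𝔤 𝔤 _ _

end Lie

/-! ### Trace functionals, Hamiltonian derivations and weights on matrices over `𝒜`. -/

section Core

variable {𝔤 : Type*} [LieRing 𝔤] [LieAlgebra ℂ 𝔤] [FiniteDimensional ℂ 𝔤] [IsSemisimple ℂ 𝔤]
variable {H : LieSubalgebra ℂ 𝔤} [H.IsCartanSubalgebra]
variable {n : Type*} [Fintype n] [DecidableEq n] {𝒜 : Type*} [CommRing 𝒜] [Algebra ℂ 𝒜]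

section Constants

theorem const_mul (X Y : Matrix n n ℂ) : const 𝒜 (X * Y) = const 𝒜 X * const 𝒜 Y :=
  Matrix.map_mul

/-- The representation `ρ` with values in constant matrices over `𝒜`. -/
noncomputable def constRep (𝒜 : Type*) [CommRing 𝒜] [Algebra ℂ 𝒜] (ρ : 𝔤 →ₗ⁅ℂ⁆ Matrix n n ℂ) :
    𝔤 →ₗ⁅ℂ⁆ Matrix n n 𝒜 :=
  ((Algebra.ofId ℂ 𝒜).mapMatrix : Matrix n n ℂ →ₐ[ℂ] Matrix n n 𝒜).toLieHom.comp ρ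

theorem constRep_apply (ρ : 𝔤 →ₗ⁅ℂ⁆ Matrix n n ℂ) (X : 𝔤) :
    constRep 𝒜 ρ X = const 𝒜 (ρ X) := rfl

theorem constRep_lie (ρ : 𝔤 →ₗ⁅ℂ⁆ Matrix n n ℂ) (X Y : 𝔤) :
    constRep 𝒜 ρ ⁅X, Y⁆ = constRep 𝒜 ρ X * constRep 𝒜 ρ Y - constRep 𝒜 ρ Y * constRep 𝒜 ρ X :=
  LieHom.map_lie _ _ _

theorem isNilpotent_smul_constRep (ρ : 𝔤 →ₗ⁅ℂ⁆ Matrix n n ℂ) {α : H → ℂ} (hα : α ≠ 0) {e : 𝔤}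
    (he : e ∈ rootSpace H α) (x : 𝒜) : IsNilpotent (x • constRep 𝒜 ρ e) := by
  have h : IsNilpotent (constRep 𝒜 ρ e) :=
    (isNilpotent_map_of_mem_rootSpace ρ hα he).map
      ((Algebra.ofId ℂ 𝒜).mapMatrix : Matrix n n ℂ →ₐ[ℂ] Matrix n n 𝒜)
  exact h.smul x

/-- The functional `X ↦ tr (G X)`. -/
noncomputable def traceWith (G : Matrix n n ℂ) : Matrix n n 𝒜 →ₗ[𝒜] 𝒜 :=
  (Matrix.traceLinearMap n 𝒜 𝒜).comp (LinearMap.mulLeft 𝒜 (const 𝒜 G))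

theorem traceWith_apply (G : Matrix n n ℂ) (X : Matrix n n 𝒜) :
    traceWith G X = (const 𝒜 G * X).trace := rfl

theorem traceWith_eq_sum (G : Matrix n n ℂ) (X : Matrix n n 𝒜) :
    traceWith G X = ∑ a, ∑ a', G a' a • X a a' := by
  rw [traceWith_apply, Matrix.trace, Finset.sum_comm]
  simp [Matrix.mul_apply, const, Algebra.smul_def]

end Constants

section Derivation

variable (P : PoissonBracket 𝒜)

theorem bracket_self (x : 𝒜) : P.bracket x x = 0 := by
  have h : (2 : ℂ) • P.bracket x x = 0 := by
    rw [two_smul]; nth_rw 1 [P.skew x x]; simp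
  simpa using h

theorem bracket_algebraMap (x : 𝒜) (t : ℂ) : P.bracket x (algebraMap ℂ 𝒜 t) = 0 := by
  have h1 : P.bracket x 1 = 0 := by
    have := P.leibniz x 1 1
    simpa using this
  rw [Algebra.algebraMap_eq_smul_one, map_smul, h1, smul_zero]

theorem map_bracket_mul (x : 𝒜) (X Y : Matrix n n 𝒜) :
    (X * Y).map (P.bracket x) = X.map (P.bracket x) * Y + X * Y.map (P.bracket x) := by
  ext a b
  simp [Matrix.mul_apply, P.leibniz, Finset.sum_add_distrib]

/-- The matrices whose entries Poisson commute with `x`. -/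
noncomputable def centralizer (x : 𝒜) : Subalgebra ℂ (Matrix n n 𝒜) where
  carrier := {X | X.map (P.bracket x) = 0}
  mul_mem' {X Y} hX hY := by
    simp only [Set.mem_ofPred_eq] at *
    rw [map_bracket_mul, hX, hY]; simp
  add_mem' {X Y} hX hY := by
    simp only [Set.mem_ofPred_eq] at *
    rw [Matrix.map_add _ (map_add _), hX, hY, add_zero]
  algebraMap_mem' t := by
    ext a b
    by_cases h : a = b <;> simp [Matrix.algebraMap_matrix_apply, h, bracket_algebraMap]

theorem const_mem_centralizer (x : 𝒜) (X : Matrix n n ℂ) : const 𝒜 X ∈ centralizer P x := by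
  change (const 𝒜 X).map (P.bracket x) = 0
  ext a b
  simp [const, bracket_algebraMap]

theorem smul_const_mem_centralizer (x : 𝒜) (X : Matrix n n ℂ) :
    x • const 𝒜 X ∈ centralizer P x := by
  change (x • const 𝒜 X).map (P.bracket x) = 0
  ext a b
  simp [const, bracket_algebraMap, P.leibniz, bracket_self]

theorem traceWith_map_bracket (G : Matrix n n ℂ) (x : 𝒜) (X : Matrix n n 𝒜) :
    traceWith G (X.map (P.bracket x)) = P.bracket x (traceWith G X) := by
  simp [traceWith_eq_sum]

end Derivation

section Contraction

/-- Application of `X ↦ tr (G X)` to the first tensor factor. -/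
noncomputable def contractLeft (G : Matrix n n ℂ) :
    Matrix (n × n) (n × n) 𝒜 →ₗ[ℂ] Matrix n n 𝒜 where
  toFun Z := Matrix.of fun b b' => ∑ a, ∑ a', G a' a • Z (a, b) (a', b')
  map_add' Z W := by ext; simp [Finset.sum_add_distrib]
  map_smul' t Z := by ext; simp [Finset.smul_sum, smul_comm t]

theorem contractLeft_kronecker (G : Matrix n n ℂ) (X Y : Matrix n n 𝒜) :
    contractLeft G (X ⊗ₖ Y) = traceWith G X • Y := by
  ext b b'
  simp [contractLeft, traceWith_eq_sum, Finset.sum_mul]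

theorem contractLeft_tensorBracket (P : PoissonBracket 𝒜) (G : Matrix n n ℂ)
    (X Y : Matrix n n 𝒜) :
    contractLeft G (tensorBracket P X Y) = Y.map (P.bracket (traceWith G X)) := by
  ext b b'
  simp [contractLeft, tensorBracket, traceWith_eq_sum]

end Contraction

section Weights

variable (ρ : 𝔤 →ₗ⁅ℂ⁆ Matrix n n ℂ)

/-- `ψ` vanishes on all weight spaces of the adjoint action of `H` except that of weight `μ`. -/
def IsWeightFunctional (μ : Dual ℂ H) (ψ : Matrix n n 𝒜 →ₗ[𝒜] 𝒜) : Prop :=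
  ∀ (h : H) (X : Matrix n n 𝒜),
    ψ (constRep 𝒜 ρ h * X - X * constRep 𝒜 ρ h) = μ h • ψ X

variable {ρ} {μ : Dual ℂ H} {ψ : Matrix n n 𝒜 →ₗ[𝒜] 𝒜}

theorem IsWeightFunctional.eq_zero (hψ : IsWeightFunctional ρ μ ψ) (h : H) {t : ℂ}
    (ht : μ h ≠ t) {X : Matrix n n 𝒜}
    (hX : constRep 𝒜 ρ h * X - X * constRep 𝒜 ρ h = t • X) : ψ X = 0 := by
  have h1 := hψ h X
  rw [hX, ← algebraMap_smul 𝒜 t X, map_smul, algebraMap_smul] at h1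
  have h2 : (μ h - t) • ψ X = 0 := by rw [sub_smul, ← h1, sub_self]
  simpa [sub_ne_zero.mpr ht] using h2

theorem constRep_lie_of_mem_rootSpace {α : H → ℂ} {e : 𝔤} (he : e ∈ rootSpace H α) (h : H) :
    constRep 𝒜 ρ h * constRep 𝒜 ρ e - constRep 𝒜 ρ e * constRep 𝒜 ρ h =
      α h • constRep 𝒜 ρ e := by
  rw [← constRep_lie, ← map_smul]
  exact congrArg _ (lie_eq_smul_of_mem_rootSpace he h)

theorem IsWeightFunctional.eq_zero_of_mem_rootSpace (hψ : IsWeightFunctional ρ μ ψ) {α : H → ℂ}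
    (hα : (μ : H → ℂ) ≠ α) {e : 𝔤} (he : e ∈ rootSpace H α) : ψ (constRep 𝒜 ρ e) = 0 := by
  obtain ⟨h, hh⟩ := Function.ne_iff.mp hα
  exact hψ.eq_zero h hh (constRep_lie_of_mem_rootSpace he h)

/-- The functional sees only elements of degree `k` under `h`, and all generators here have larger
degree. -/
theorem IsWeightFunctional.eq_zero_of_mem_degGE (hψ : IsWeightFunctional ρ μ ψ) (h : H) {m k : ℕ}
    (hk : μ h = k) (hm : k < m) {X : Matrix n n 𝒜}
    (hX : X ∈ degGE 𝒜 (constRep 𝒜 ρ h) m) : ψ X = 0 := by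
  have hle : degGE 𝒜 (constRep 𝒜 ρ h) m ≤ LinearMap.ker ψ := by
    rw [degGE, Submodule.span_le]
    rintro X ⟨l, hl, hX⟩
    refine hψ.eq_zero h ?_ hX
    rw [hk]
    exact_mod_cast (by omega : k ≠ l)
  exact hle hX

theorem isWeightFunctional_traceWith {α : H → ℂ} (hα : (μ : H → ℂ) = -α) {f : 𝔤}
    (hf : f ∈ rootSpace H α) (t : ℂ) :
    IsWeightFunctional ρ μ (traceWith (𝒜 := 𝒜) (t • ρ f)) := by
  intro h X
  have h1 := constRep_lie_of_mem_rootSpace (𝒜 := 𝒜) (ρ := ρ) hf h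
  have h2 : μ h = -α h := congrFun hα h
  have h3 : const 𝒜 (t • ρ f) = t • constRep 𝒜 ρ f := by
    ext; simp [constRep_apply, const, ← Algebra.smul_def]
  rw [traceWith_apply, traceWith_apply, h3, h2]
  have h4 : (t • constRep 𝒜 ρ f * (constRep 𝒜 ρ h * X - X * constRep 𝒜 ρ h)).trace =
      -(t • ((constRep 𝒜 ρ h * constRep 𝒜 ρ f - constRep 𝒜 ρ f * constRep 𝒜 ρ h) * X)).trace := by
    rw [mul_sub, Matrix.trace_sub, ← mul_assoc, ← mul_assoc, Matrix.trace_mul_comm _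
      (constRep 𝒜 ρ h), sub_mul, smul_sub, Matrix.trace_sub]
    simp only [smul_mul_assoc, mul_smul_comm, Matrix.mul_assoc]
    abel
  rw [h4, h1]
  simp only [smul_mul_assoc, Matrix.trace_smul, neg_smul]
  rw [smul_comm]

/-- `X ↦ ψ [f, X]`. -/
noncomputable def adFunctional (ρ : 𝔤 →ₗ⁅ℂ⁆ Matrix n n ℂ) (f : 𝔤) (ψ : Matrix n n 𝒜 →ₗ[𝒜] 𝒜) :
    Matrix n n 𝒜 →ₗ[𝒜] 𝒜 :=
  ψ.comp (LinearMap.mulLeft 𝒜 (constRep 𝒜 ρ f) - LinearMap.mulRight 𝒜 (constRep 𝒜 ρ f))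

theorem adFunctional_apply (f : 𝔤) (X : Matrix n n 𝒜) :
    adFunctional ρ f ψ X = ψ (constRep 𝒜 ρ f * X - X * constRep 𝒜 ρ f) := rfl

/-- Since `ad f` lowers weights by `α`, precomposing with it raises the weight that the functional
detects. -/
theorem IsWeightFunctional.adFunctional (hψ : IsWeightFunctional ρ μ ψ) {α : Dual ℂ H} {f : 𝔤}
    (hf : f ∈ rootSpace H (-α : H → ℂ)) : IsWeightFunctional ρ (μ + α) (adFunctional ρ f ψ) := by
  intro h X
  rw [adFunctional_apply, adFunctional_apply]
  have h1 := constRep_lie_of_mem_rootSpace (𝒜 := 𝒜) (ρ := ρ) hf h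
  set F := constRep 𝒜 ρ f
  set h' := constRep 𝒜 ρ (h : 𝔤)
  have h2 : F * (h' * X - X * h') - (h' * X - X * h') * F =
      (h' * (F * X - X * F) - (F * X - X * F) * h') -
        ((h' * F - F * h') * X - X * (h' * F - F * h')) := by noncomm_ring
  rw [h2, h1, map_sub, hψ]
  have h3 : (-α : H → ℂ) h • F * X - X * ((-α : H → ℂ) h • F) =
      (algebraMap ℂ 𝒜 (-α h)) • (F * X - X * F) := by
    rw [algebraMap_smul, smul_sub, smul_mul_assoc, mul_smul_comm]; rfl
  rw [h3, map_smul, algebraMap_smul, LinearMap.add_apply, add_smul, neg_smul, sub_neg_eq_add]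

end Weights
end Core

/-! ### The Casimir tensor commutes with `M ⊗ M`; contraction of the bracket relation. -/

section Core

variable {𝔤 : Type*} [LieRing 𝔤] [LieAlgebra ℂ 𝔤] [FiniteDimensional ℂ 𝔤] [IsSemisimple ℂ 𝔤]
variable {H : LieSubalgebra ℂ 𝔤} [H.IsCartanSubalgebra]
variable {n : Type*} [Fintype n] [DecidableEq n] {𝒜 : Type*} [CommRing 𝒜] [Algebra ℂ 𝒜]
variable {N : ℕ} {δ : Fin N → Weight ℂ H 𝔤} {E : Weight ℂ H 𝔤 → 𝔤}
  {ι : Type*} [Fintype ι] [DecidableEq ι] {K : Basis ι ℂ H} {ρ : 𝔤 →ₗ⁅ℂ⁆ Matrix n n ℂ}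

section CasimirTensor

theorem leg₁_mul_leg₂ (X Y : Matrix n n 𝒜) : leg₁ X * leg₂ Y = X ⊗ₖ Y := by
  rw [leg₁, leg₂, ← Matrix.mul_kronecker_mul, mul_one, one_mul]

theorem leg₂_mul_leg₁ (X Y : Matrix n n 𝒜) : leg₂ X * leg₁ Y = Y ⊗ₖ X := by
  rw [leg₁, leg₂, ← Matrix.mul_kronecker_mul, mul_one, one_mul]

theorem sub_kronecker (X X' Y : Matrix n n 𝒜) : (X - X') ⊗ₖ Y = X ⊗ₖ Y - X' ⊗ₖ Y := by
  ext; simp [sub_mul]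

theorem kronecker_sub (X Y Y' : Matrix n n 𝒜) : X ⊗ₖ (Y - Y') = X ⊗ₖ Y - X ⊗ₖ Y' := by
  ext; simp [mul_sub]

/-- `X ↦ X ⊗ 1` as a ring homomorphism. -/
def leg₁Hom : Matrix n n 𝒜 →+* Matrix (n × n) (n × n) 𝒜 where
  toFun := leg₁
  map_one' := Matrix.one_kronecker_one
  map_mul' X Y := by rw [leg₁, leg₁, leg₁, ← Matrix.mul_kronecker_mul, mul_one]
  map_zero' := Matrix.zero_kronecker _
  map_add' X Y := Matrix.add_kronecker _ _ _

/-- `X ↦ 1 ⊗ X` as a ring homomorphism. -/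
def leg₂Hom : Matrix n n 𝒜 →+* Matrix (n × n) (n × n) 𝒜 where
  toFun := leg₂
  map_one' := Matrix.one_kronecker_one
  map_mul' X Y := by rw [leg₂, leg₂, leg₂, ← Matrix.mul_kronecker_mul, mul_one]
  map_zero' := Matrix.kronecker_zero _
  map_add' X Y := Matrix.kronecker_add _ _ _

/-- The two legs commute, so `exp a ⊗ exp a = exp (a ⊗ 1 + 1 ⊗ a)`: the exponential is group-like.
-/
theorem commute_nilExp_kronecker {C : Matrix (n × n) (n × n) 𝒜} {a : Matrix n n 𝒜}
    (ha : IsNilpotent a) (hC : Commute C (leg₁ a + leg₂ a)) :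
    Commute C (nilExp a ⊗ₖ nilExp a) := by
  have hc : Commute (leg₁ a) (leg₂ a) := by
    rw [Commute, SemiconjBy, leg₁_mul_leg₂, leg₂_mul_leg₁]
  have h1 : IsNilpotent (leg₁ a) := ha.map (leg₁Hom (n := n) (𝒜 := 𝒜))
  have h2 : IsNilpotent (leg₂ a) := ha.map (leg₂Hom (n := n) (𝒜 := 𝒜))
  have e1 : leg₁ (nilExp a) = nilExp (leg₁ a) := map_nilExp ha leg₁Hom
  have e2 : leg₂ (nilExp a) = nilExp (leg₂ a) := map_nilExp ha leg₂Hom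
  rw [← leg₁_mul_leg₂, e1, e2, ← nilExp_add hc h1 h2]
  exact commute_nilExp (hc.isNilpotent_add h1 h2) hC

theorem commute_prod_kronecker {C : Matrix (n × n) (n × n) 𝒜} (l : List (Matrix n n 𝒜))
    (hl : ∀ X ∈ l, Commute C (X ⊗ₖ X)) : Commute C (l.prod ⊗ₖ l.prod) := by
  induction l with
  | nil => simp
  | cons a l ih =>
    rw [List.prod_cons, Matrix.mul_kronecker_mul]
    exact (hl a List.mem_cons_self).mul_right (ih fun X hX => hl X (List.mem_cons_of_mem _ hX))

variable (𝒜 δ E K ρ)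

/-- `∑ E_δ ⊗ E_{-δ}`. -/
noncomputable def halfTensor : Matrix (n × n) (n × n) 𝒜 :=
  ∑ k, constRep 𝒜 ρ (E (δ k)) ⊗ₖ constRep 𝒜 ρ (E (-δ k))

/-- `∑ E_{-δ} ⊗ E_δ`. -/
noncomputable def oppTensor : Matrix (n × n) (n × n) 𝒜 :=
  ∑ k, constRep 𝒜 ρ (E (-δ k)) ⊗ₖ constRep 𝒜 ρ (E (δ k))

/-- `∑ K ⊗ K`. -/
noncomputable def cartanTensor : Matrix (n × n) (n × n) 𝒜 :=
  ∑ a, constRep 𝒜 ρ (K a : 𝔤) ⊗ₖ constRep 𝒜 ρ (K a : 𝔤)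

/-- The standard `R`-matrix attached to a half system of roots. -/
noncomputable def halfR (c : ℂ) : Matrix (n × n) (n × n) ℂ :=
  c • ∑ k, (ρ (E (δ k)) ⊗ₖ ρ (E (-δ k)) - ρ (E (-δ k)) ⊗ₖ ρ (E (δ k)))

theorem const_halfR (c : ℂ) :
    const 𝒜 (halfR δ E ρ c) = c • (halfTensor 𝒜 δ E ρ - oppTensor 𝒜 δ E ρ) := by
  rw [halfTensor, oppTensor, ← Finset.sum_sub_distrib]
  ext a b
  simp [const, halfR, constRep_apply, Matrix.sum_apply, ← Algebra.smul_def]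

theorem const_hTensor (c : ℂ) :
    const 𝒜 (hTensor c K ρ) = c • cartanTensor 𝒜 K ρ := by
  ext a b
  simp [const, hTensor, cartanTensor, constRep_apply, Matrix.sum_apply, ← Algebra.smul_def]

variable {𝒜 δ E K ρ}

theorem commute_casimir_leg (hδ : IsHalfSystem δ) (hE : IsCartanWeyl E)
    (hK : ∀ a a' : ι, killingForm ℂ 𝔤 (K a) (K a') = if a = a' then 1 else 0) (Y : 𝔤) (x : 𝒜) :
    Commute (halfTensor 𝒜 δ E ρ + oppTensor 𝒜 δ E ρ + cartanTensor 𝒜 K ρ)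
      (leg₁ (x • constRep 𝒜 ρ Y) + leg₂ (x • constRep 𝒜 ρ Y)) := by
  let T : 𝔤 →ₗ[ℂ] 𝔤 →ₗ[ℂ] Matrix (n × n) (n × n) 𝒜 :=
    LinearMap.mk₂ ℂ (fun X Y => constRep 𝒜 ρ X ⊗ₖ constRep 𝒜 ρ Y)
      (fun X X' Y => by rw [map_add, Matrix.add_kronecker])
      (fun t X Y => by rw [map_smul, Matrix.smul_kronecker])
      (fun X Y Y' => by rw [map_add, Matrix.kronecker_add])
      (fun t X Y => by rw [map_smul, Matrix.kronecker_smul])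
  set y := constRep 𝒜 ρ Y
  have hT : ∀ u v : 𝔤, T ⁅Y, u⁆ v + T u ⁅Y, v⁆ = (leg₁ y + leg₂ y) *
      (constRep 𝒜 ρ u ⊗ₖ constRep 𝒜 ρ v) - (constRep 𝒜 ρ u ⊗ₖ constRep 𝒜 ρ v) *
        (leg₁ y + leg₂ y) := by
    intro u v
    simp only [T, LinearMap.mk₂_apply, constRep_lie, add_mul, mul_add, leg₁, leg₂,
      ← Matrix.mul_kronecker_mul, one_mul, mul_one, sub_kronecker, kronecker_sub]
    abel
  have key := casimir_invariant hδ hE hK T Y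
  simp only [hT, Finset.sum_sub_distrib, ← Finset.mul_sum, ← Finset.sum_mul] at key
  have hx : leg₁ (x • y) + leg₂ (x • y) = x • (leg₁ y + leg₂ y) := by
    rw [leg₁, leg₂, Matrix.smul_kronecker, Matrix.kronecker_smul, smul_add]; rfl
  rw [hx]
  refine Commute.smul_right ?_ x
  rw [Commute, SemiconjBy, ← sub_eq_zero, ← neg_eq_zero, ← key]
  simp only [halfTensor, oppTensor, cartanTensor, add_mul, mul_add]
  abel

end CasimirTensor

/-- Contraction of the bracket relation in its first leg. -/
theorem map_bracket_of_bracketRelation {P : PoissonBracket 𝒜} {γ c : ℂ} {M : Matrix n n 𝒜}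
    (hrel : BracketRelation P γ 1 (halfR δ E ρ c) (hTensor c K ρ) M)
    (hC : Commute (halfTensor 𝒜 δ E ρ + oppTensor 𝒜 δ E ρ + cartanTensor 𝒜 K ρ) (M ⊗ₖ M))
    (hK : ∀ a a' : ι, killingForm ℂ 𝔤 (K a) (K a') = if a = a' then 1 else 0)
    {G : Matrix n n ℂ} {p : Fin N}
    (hG : IsWeightFunctional ρ ((δ p).toLinear : Dual ℂ H) (traceWith (𝒜 := 𝒜) G))
    (hl : ∀ k, traceWith G (constRep 𝒜 ρ (E (δ k)) * M) = if k = p then 1 else 0)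
    (hr : ∀ k, traceWith G (M * constRep 𝒜 ρ (E (δ k))) = if k = p then 1 else 0) :
    M.map (P.bracket (traceWith G M)) = (c * γ) •
      ((2 : ℂ) • (constRep 𝒜 ρ (E (-δ p)) * M - M * constRep 𝒜 ρ (E (-δ p))) +
        traceWith G M •
          (constRep 𝒜 ρ ((cartanEquivDual H).symm (δ p).toLinear : H) * M +
            M * constRep 𝒜 ρ ((cartanEquivDual H).symm (δ p).toLinear : H))) := by
  have h1 : tensorBracket P M M = (c * γ) •
      ((2 : ℂ) • (halfTensor 𝒜 δ E ρ * (M ⊗ₖ M) - (M ⊗ₖ M) * halfTensor 𝒜 δ E ρ) +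
        (cartanTensor 𝒜 K ρ * (M ⊗ₖ M) - (M ⊗ₖ M) * cartanTensor 𝒜 K ρ
          - leg₁ M * cartanTensor 𝒜 K ρ * leg₂ M + leg₂ M * cartanTensor 𝒜 K ρ * leg₁ M)) := by
    -- Commutation with the Casimir tensor eliminates the opposite half, which doubles the other
    -- half and adds a Cartan commutator.
    have hC' : oppTensor 𝒜 δ E ρ * (M ⊗ₖ M) - (M ⊗ₖ M) * oppTensor 𝒜 δ E ρ =
        -(halfTensor 𝒜 δ E ρ * (M ⊗ₖ M) - (M ⊗ₖ M) * halfTensor 𝒜 δ E ρ) -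
          (cartanTensor 𝒜 K ρ * (M ⊗ₖ M) - (M ⊗ₖ M) * cartanTensor 𝒜 K ρ) := by
      rw [← sub_eq_zero, ← sub_eq_zero.mpr hC.eq]
      simp only [add_mul, mul_add]
      abel
    rw [hrel, const_halfR, const_hTensor, leg₁_mul_leg₂, mul_comm c γ, mul_smul]
    congr 1
    have h2 : (c • (halfTensor 𝒜 δ E ρ - oppTensor 𝒜 δ E ρ)) * (M ⊗ₖ M) -
        (M ⊗ₖ M) * (c • (halfTensor 𝒜 δ E ρ - oppTensor 𝒜 δ E ρ)) =
        c • ((halfTensor 𝒜 δ E ρ * (M ⊗ₖ M) - (M ⊗ₖ M) * halfTensor 𝒜 δ E ρ) -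
          (oppTensor 𝒜 δ E ρ * (M ⊗ₖ M) - (M ⊗ₖ M) * oppTensor 𝒜 δ E ρ)) := by
      simp only [smul_mul_assoc, mul_smul_comm, ← smul_sub, sub_mul, mul_sub]
      congr 1
      abel
    rw [h2, hC', one_smul, one_smul, two_smul]
    simp only [smul_mul_assoc, mul_smul_comm]
    rw [← smul_sub, ← smul_add]
    congr 1
    abel
  have h2 := congrArg (contractLeft G) h1
  rw [contractLeft_tensorBracket] at h2
  rw [h2, map_smul, map_add, map_smul]
  congr 3
  -- By `hl` and `hr`, only the summand `k = p` survives the contraction, with coefficient `1` on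
  -- both sides.
  · rw [map_sub, halfTensor, Finset.sum_mul, Finset.mul_sum, map_sum, map_sum]
    simp only [← Matrix.mul_kronecker_mul, contractLeft_kronecker, hl, hr]
    simp
  · have hh : constRep 𝒜 ρ ((cartanEquivDual H).symm (δ p).toLinear : H) =
        ∑ a, δ p (K a) • constRep 𝒜 ρ (K a : 𝔤) := by
      rw [← sum_apply_smul_eq K hK]
      have : ((∑ a, ((δ p).toLinear : Dual ℂ H) (K a) • K a : H) : 𝔤) =
        ∑ a, ((δ p).toLinear : Dual ℂ H) (K a) • (K a : 𝔤) := by simp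
      rw [this, map_sum]
      simp
    have e1 : ∀ a, leg₁ M * (constRep 𝒜 ρ (K a : 𝔤) ⊗ₖ constRep 𝒜 ρ (K a : 𝔤)) * leg₂ M =
        (M * constRep 𝒜 ρ (K a : 𝔤)) ⊗ₖ (constRep 𝒜 ρ (K a : 𝔤) * M) := fun a => by
      rw [leg₁, leg₂, ← Matrix.mul_kronecker_mul, ← Matrix.mul_kronecker_mul, mul_one, one_mul]
    have e2 : ∀ a, leg₂ M * (constRep 𝒜 ρ (K a : 𝔤) ⊗ₖ constRep 𝒜 ρ (K a : 𝔤)) * leg₁ M =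
        (constRep 𝒜 ρ (K a : 𝔤) * M) ⊗ₖ (M * constRep 𝒜 ρ (K a : 𝔤)) := fun a => by
      rw [leg₁, leg₂, ← Matrix.mul_kronecker_mul, ← Matrix.mul_kronecker_mul, mul_one, one_mul]
    rw [cartanTensor, hh]
    simp only [Finset.sum_mul, Finset.mul_sum, map_add, map_sub, map_sum, e1, e2,
      ← Matrix.mul_kronecker_mul, contractLeft_kronecker]
    rw [← Finset.sum_sub_distrib, ← Finset.sum_sub_distrib, ← Finset.sum_add_distrib,
      ← Finset.sum_add_distrib, Finset.smul_sum]
    refine Finset.sum_congr rfl fun a _ => ?_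
    have h3 := hG (K a) M
    rw [map_sub, Weight.toLinear_apply] at h3
    set k := constRep 𝒜 ρ (K a : 𝔤)
    -- For each `k = K a` the Cartan terms combine to `[k, M] ⊗ (k M + M k)`, and the weight of the
    -- functional evaluates the first leg.
    have h4 : traceWith G (k * M) = traceWith G (M * k) + δ p (K a) • traceWith G M := by
      rw [← h3]; abel
    rw [h4, smul_mul_assoc, mul_smul_comm, ← smul_add (δ p (K a)), smul_comm, ← smul_assoc]
    simp only [add_smul, smul_add]
    abel

end Core

/-! ### Linearisation by `sl₂` conjugation, and the nested brackets. -/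

section Core

variable {𝔤 : Type*} [LieRing 𝔤] [LieAlgebra ℂ 𝔤] [FiniteDimensional ℂ 𝔤] [IsSemisimple ℂ 𝔤]
variable {H : LieSubalgebra ℂ 𝔤} [H.IsCartanSubalgebra]
variable {n : Type*} [Fintype n] [DecidableEq n] {𝒜 : Type*} [CommRing 𝒜] [Algebra ℂ 𝒜]
variable {N : ℕ} {δ : Fin N → Weight ℂ H 𝔤} {E : Weight ℂ H 𝔤 → 𝔤}
  {ι : Type*} [Fintype ι] [DecidableEq ι] {K : Basis ι ℂ H} {ρ : 𝔤 →ₗ⁅ℂ⁆ Matrix n n ℂ}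

section Conjugation

variable {B : Type*} [Ring B] [Algebra ℂ B] [Algebra 𝒜 B] [IsScalarTower ℂ 𝒜 B]

theorem nilExp_conj_of_lie_eq {a y z w : B} (h : IsNilpotent a) (h1 : a * y - y * a = z)
    (h2 : a * z - z * a = w) (h3 : a * w - w * a = 0) :
    nilExp a * y * nilExp (-a) = y + z + (2 : ℂ)⁻¹ • w := by
  have e1 : ad ℂ B a y = z := h1
  have e2 : ad ℂ B a z = w := h2
  have e3 : ad ℂ B a w = 0 := h3
  rw [nilExp_conj h y (k := 3) (by simp [pow_succ', e1, e2, e3])]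
  simp [Finset.sum_range_succ, pow_succ', e1, e2, Nat.factorial]

variable {e f h : B} {s : ℂ} (hef : e * f - f * e = h) (hhe : h * e - e * h = s • e)
include hef hhe

/-- The series for `ad (x e)` stops after two brackets: `f ↦ x h ↦ -s x² e ↦ 0`. -/
theorem nilExp_conj_lowering (x : 𝒜) (hx : IsNilpotent (x • e)) :
    nilExp (x • e) * f * nilExp (-(x • e)) = f + x • h - ((2 : ℂ)⁻¹ * s) • x ^ 2 • e := by
  have h2 : (x • e) * (x • h) - (x • h) * (x • e) = -(s • x ^ 2 • e) := by
    have : (x • e) * (x • h) - (x • h) * (x • e) = -(x ^ 2 • (h * e - e * h)) := by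
      simp only [smul_mul_assoc, mul_smul_comm, smul_smul, smul_sub, pow_two]; abel
    rw [this, hhe, smul_comm]
  rw [nilExp_conj_of_lie_eq hx (z := x • h) (w := -(s • x ^ 2 • e)) _ h2]
  · rw [smul_neg, smul_smul, sub_eq_add_neg]
  · simp only [smul_mul_assoc, mul_smul_comm, mul_neg, neg_mul]
    rw [smul_neg, smul_comm x s, smul_smul x, smul_smul (x ^ 2), mul_comm x]; abel
  · rw [smul_mul_assoc, mul_smul_comm, ← smul_sub, hef]

theorem nilExp_conj_cartan (x : 𝒜) (hx : IsNilpotent (x • e)) :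
    nilExp (x • e) * h * nilExp (-(x • e)) = h - s • x • e := by
  have h1 : (x • e) * h - h * (x • e) = -(s • x • e) := by
    rw [smul_mul_assoc, mul_smul_comm, ← smul_sub, ← neg_sub, hhe, smul_neg, smul_comm]
  rw [nilExp_conj_of_lie_eq hx h1 (w := 0), smul_zero, add_zero, sub_eq_add_neg]
  · simp only [smul_mul_assoc, mul_smul_comm, mul_neg, neg_mul]
    rw [smul_neg, smul_comm x s]; abel
  · simp

/-- Right multiplication by `exp (-x e)` linearises the derivation. -/
theorem linearise_right {M : B} (x : 𝒜) (hx : IsNilpotent (x • e)) :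
    ((2 : ℂ) • (f * M - M * f) + x • (h * M + M * h)) * nilExp (-(x • e)) =
      (2 : ℂ) • (f * (M * nilExp (-(x • e))) - M * nilExp (-(x • e)) * f) +
        x • (h * (M * nilExp (-(x • e))) - M * nilExp (-(x • e)) * h) := by
  set v := nilExp (-(x • e)) with hv
  set u := nilExp (x • e) with hu
  have hvu : v * u = 1 := nilExp_neg_mul_nilExp hx
  -- Moving `f` and `h` across `v` produces two `x² e` terms that cancel, while the `x h` term,
  -- doubled, turns the anticommutator with `h` into a commutator.
  have c1 : f * v = v * (f + x • h - ((2 : ℂ)⁻¹ * s) • x ^ 2 • e) := by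
    rw [← nilExp_conj_lowering hef hhe x hx, ← hu, ← hv, ← mul_assoc, ← mul_assoc, hvu, one_mul]
  have c2 : h * v = v * (h - s • x • e) := by
    rw [← nilExp_conj_cartan hef hhe x hx, ← hu, ← hv, ← mul_assoc, ← mul_assoc, hvu, one_mul]
  have c3 : (2 : ℂ) • ((2 : ℂ)⁻¹ * s) • x ^ 2 • (M * (v * e)) = s • x ^ 2 • (M * (v * e)) := by
    rw [smul_smul, mul_inv_cancel_left₀ two_ne_zero]
  rw [add_mul, smul_mul_assoc, smul_mul_assoc, sub_mul, add_mul, mul_assoc f, mul_assoc M f,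
    mul_assoc h, mul_assoc M h, c1, c2]
  simp only [mul_add, mul_sub, smul_sub, smul_add, mul_smul_comm, mul_assoc, c3]
  rw [smul_comm x s, smul_smul x x, ← pow_two, two_smul ℂ (x • _)]
  abel

/-- Left multiplication by `exp (-x e)` linearises the derivation. -/
theorem linearise_left {M : B} (x : 𝒜) (hx : IsNilpotent (x • e)) :
    nilExp (-(x • e)) * ((2 : ℂ) • (f * M - M * f) + x • (h * M + M * h)) =
      (2 : ℂ) • (f * (nilExp (-(x • e)) * M) - nilExp (-(x • e)) * M * f) -
        x • (h * (nilExp (-(x • e)) * M) - nilExp (-(x • e)) * M * h) := by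
  set v := nilExp (-(x • e)) with hv
  set u := nilExp (x • e) with hu
  have hneg : (-x) • e = -(x • e) := neg_smul x e
  have hx' : IsNilpotent ((-x) • e) := hneg ▸ hx.neg
  have huv : u * v = 1 := nilExp_mul_nilExp_neg hx
  have c1 : v * f = (f - x • h - ((2 : ℂ)⁻¹ * s) • x ^ 2 • e) * v := by
    have := nilExp_conj_lowering hef hhe (-x) hx'
    rw [hneg, neg_neg, neg_smul, neg_sq, ← sub_eq_add_neg, ← hu, ← hv] at this
    rw [← this, mul_assoc (v * f), huv, mul_one]
  have c2 : v * h = (h + s • x • e) * v := by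
    have := nilExp_conj_cartan hef hhe (-x) hx'
    rw [hneg, neg_neg, smul_neg, sub_neg_eq_add, ← hu, ← hv] at this
    rw [← this, mul_assoc (v * h), huv, mul_one]
  have c3 : (2 : ℂ) • ((2 : ℂ)⁻¹ * s) • x ^ 2 • (e * (v * M)) = s • x ^ 2 • (e * (v * M)) := by
    rw [smul_smul, mul_inv_cancel_left₀ two_ne_zero]
  rw [mul_add, mul_smul_comm, mul_smul_comm, mul_sub, mul_add, ← mul_assoc v f, ← mul_assoc v h,
    ← mul_assoc v M, ← mul_assoc v M, c1, c2]
  simp only [add_mul, sub_mul, smul_sub, smul_add, smul_mul_assoc, mul_assoc, c3]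
  rw [smul_comm x s, smul_smul x x, ← pow_two, two_smul ℂ (x • _)]
  abel

end Conjugation

section Nested

variable (P : PoissonBracket 𝒜)

/-- `ψ` commutes with all Hamiltonian derivations. -/
def IsConstant (ψ : Matrix n n 𝒜 →ₗ[𝒜] 𝒜) : Prop :=
  ∀ (x : 𝒜) (X : Matrix n n 𝒜), ψ (X.map (P.bracket x)) = P.bracket x (ψ X)

variable {P} {ψ : Matrix n n 𝒜 →ₗ[𝒜] 𝒜}

theorem IsConstant.adFunctional (hψ : IsConstant P ψ) (f : 𝔤) :
    IsConstant P (adFunctional ρ f ψ) := by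
  intro x X
  rw [adFunctional_apply, adFunctional_apply, ← hψ]
  have h0 : (constRep 𝒜 ρ f).map (P.bracket x) = 0 := const_mem_centralizer P x (ρ f)
  congr 1
  rw [Matrix.map_sub _ (map_sub _), map_bracket_mul, map_bracket_mul, h0]
  simp

variable {f : 𝔤} {α ν : Dual ℂ H}

theorem IsConstant.iterate_adFunctional (hψ : IsConstant P ψ) (r : ℕ) :
    IsConstant P ((QPoissonSerre.adFunctional ρ f)^[r] ψ) := by
  induction r with
  | zero => exact hψ
  | succ r ih => rw [Function.iterate_succ_apply']; exact ih.adFunctional f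

theorem IsWeightFunctional.iterate_adFunctional (hψ : IsWeightFunctional ρ ν ψ)
    (hf : f ∈ rootSpace H (-α : H → ℂ)) (r : ℕ) :
    IsWeightFunctional ρ (ν + r • α) ((QPoissonSerre.adFunctional ρ f)^[r] ψ) := by
  induction r with
  | zero => simpa using hψ
  | succ r ih =>
    rw [Function.iterate_succ_apply', succ_nsmul, ← add_assoc]
    exact ih.adFunctional hf

variable {κ : ℂ} {x : 𝒜} {Z : Matrix n n 𝒜}

/-- A constant functional passes through `{x, ·}`. Its weight turns the commutator with the vector
dual to `α` into the scalar `(α, ν + r α)`. -/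
theorem bracket_iterate_adFunctional (hc : IsConstant P ψ) (hψ : IsWeightFunctional ρ ν ψ)
    (hf : f ∈ rootSpace H (-α : H → ℂ)) {σ : ℂ}
    (hZ : Z.map (P.bracket x) = κ • ((2 : ℂ) • (constRep 𝒜 ρ f * Z - Z * constRep 𝒜 ρ f) -
      σ • x • (constRep 𝒜 ρ ((cartanEquivDual H).symm α : H) * Z -
        Z * constRep 𝒜 ρ ((cartanEquivDual H).symm α : H)))) (r : ℕ) :
    P.bracket x ((adFunctional ρ f)^[r] ψ Z) =
      (2 * κ) • (adFunctional ρ f)^[r + 1] ψ Z -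
        (κ * σ * dualForm α (ν + r • α)) • (x * (adFunctional ρ f)^[r] ψ Z) := by
  have hw := hψ.iterate_adFunctional hf r ((cartanEquivDual H).symm α) Z
  rw [← hc.iterate_adFunctional r, hZ, Function.iterate_succ_apply', adFunctional_apply,
    dualForm_eq_apply]
  set φ := (adFunctional ρ f)^[r] ψ
  have hs : ∀ (t : ℂ) (X : Matrix n n 𝒜), φ (t • X) = t • φ X := fun t X => by
    rw [← algebraMap_smul 𝒜 t X, map_smul, algebraMap_smul]
  rw [hs, map_sub, hs, hs, map_smul φ x, hw, smul_sub, smul_smul, smul_smul, smul_eq_mul,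
    mul_smul_comm, smul_smul, mul_comm 2 κ]

/-- The correction `κ (α, ν + r α) x · _` in the deformed bracket is the exact negative of the
quadratic term, so each bracket contributes only `2κ` and one more `ad f`. -/
theorem nestedLeft_eq (hc : IsConstant P ψ) (hψ : IsWeightFunctional ρ ν ψ)
    (hf : f ∈ rootSpace H (-α : H → ℂ))
    (hZ : Z.map (P.bracket x) = κ • ((2 : ℂ) • (constRep 𝒜 ρ f * Z - Z * constRep 𝒜 ρ f) -
      x • (constRep 𝒜 ρ ((cartanEquivDual H).symm α : H) * Z -
        Z * constRep 𝒜 ρ ((cartanEquivDual H).symm α : H)))) (r : ℕ) :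
    nestedLeft P κ α ν x (ψ Z) r = (2 * κ) ^ r • (adFunctional ρ f)^[r] ψ Z := by
  induction r with
  | zero => simp [nestedLeft]
  | succ r ih =>
    rw [nestedLeft, ih, qBracket, map_smul,
      bracket_iterate_adFunctional hc hψ hf (κ := κ) (σ := 1) (by rw [hZ, one_smul])]
    simp only [Algebra.smul_def, map_pow, map_mul, map_one]
    ring

/-- Skew symmetry reverses the sign of the quadratic term as well, which is why the opposite sign is
needed in the derivation formula for the same deformation parameter. -/
theorem nestedRight_eq (hc : IsConstant P ψ) (hψ : IsWeightFunctional ρ ν ψ)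
    (hf : f ∈ rootSpace H (-α : H → ℂ))
    (hZ : Z.map (P.bracket x) = κ • ((2 : ℂ) • (constRep 𝒜 ρ f * Z - Z * constRep 𝒜 ρ f) +
      x • (constRep 𝒜 ρ ((cartanEquivDual H).symm α : H) * Z -
        Z * constRep 𝒜 ρ ((cartanEquivDual H).symm α : H)))) (r : ℕ) :
    nestedRight P κ α ν x (ψ Z) r = (-(2 * κ)) ^ r • (adFunctional ρ f)^[r] ψ Z := by
  induction r with
  | zero => simp [nestedRight]
  | succ r ih =>
    rw [nestedRight, ih, qBracket, P.skew, map_smul, dualForm_comm,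
      bracket_iterate_adFunctional hc hψ hf (κ := κ) (σ := -1) (by rw [hZ, neg_one_smul, sub_neg_eq_add])]
    simp only [Algebra.smul_def, map_pow, map_mul, map_neg, map_one]
    ring

end Nested

end Core

/-! ### Coordinates of the ordered product, and vanishing at the end of a root string. -/

section Core

variable {𝔤 : Type*} [LieRing 𝔤] [LieAlgebra ℂ 𝔤] [FiniteDimensional ℂ 𝔤] [IsSemisimple ℂ 𝔤]
variable {H : LieSubalgebra ℂ 𝔤} [H.IsCartanSubalgebra]
variable {n : Type*} [Fintype n] [DecidableEq n] {𝒜 : Type*} [CommRing 𝒜] [Algebra ℂ 𝒜]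
variable {N : ℕ} {δ : Fin N → Weight ℂ H 𝔤} {E : Weight ℂ H 𝔤 → 𝔤}
  {ι : Type*} [Fintype ι] [DecidableEq ι] {K : Basis ι ℂ H} {ρ : 𝔤 →ₗ⁅ℂ⁆ Matrix n n ℂ}
  {μ : Dual ℂ H} {ψ : Matrix n n 𝒜 →ₗ[𝒜] 𝒜}

section Evaluation

variable {d : H}

theorem constRep_mem_degGE {α : H → ℂ} {e : 𝔤} (he : e ∈ rootSpace H α) {m k : ℕ}
    (hα : α d = k) (hm : m ≤ k) : constRep 𝒜 ρ e ∈ degGE 𝒜 (constRep 𝒜 ρ (d : 𝔤)) m :=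
  mem_degGE hm (by rw [constRep_lie_of_mem_rootSpace he, hα])

theorem IsWeightFunctional.map_one (hψ : IsWeightFunctional ρ μ ψ) (hμ : μ d = 1) : ψ 1 = 0 :=
  hψ.eq_zero d (t := 0) (by simp [hμ]) (by simp)

theorem IsWeightFunctional.map_prod_nilExp (hψ : IsWeightFunctional ρ μ ψ) (hμ : μ d = 1)
    (l : List (Matrix n n 𝒜))
    (hl : ∀ a ∈ l, IsNilpotent a ∧ a ∈ degGE 𝒜 (constRep 𝒜 ρ (d : 𝔤)) 1) :
    ψ (l.map nilExp).prod = ψ l.sum := by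
  have h := hψ.eq_zero_of_mem_degGE d (k := 1) (by simpa using hμ) one_lt_two
    (prod_nilExp_sub_mem_degGE l hl)
  rw [map_sub, map_sub, hψ.map_one hμ, sub_zero] at h
  exact sub_eq_zero.mp h

theorem prod_nilExp_sub_one_mem (l : List (Matrix n n 𝒜))
    (hl : ∀ a ∈ l, IsNilpotent a ∧ a ∈ degGE 𝒜 (constRep 𝒜 ρ (d : 𝔤)) 1) :
    (l.map nilExp).prod - 1 ∈ degGE 𝒜 (constRep 𝒜 ρ (d : 𝔤)) 1 := by
  have h1 := degGE_anti one_le_two (prod_nilExp_sub_mem_degGE l hl)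
  simpa using add_mem h1 (list_sum_mem fun a ha => (hl a ha).2)

theorem IsWeightFunctional.map_mul_left (hψ : IsWeightFunctional ρ μ ψ) (hμ : μ d = 1)
    {a M : Matrix n n 𝒜} (ha : a ∈ degGE 𝒜 (constRep 𝒜 ρ (d : 𝔤)) 1)
    (hM : M - 1 ∈ degGE 𝒜 (constRep 𝒜 ρ (d : 𝔤)) 1) : ψ (a * M) = ψ a := by
  have h := hψ.eq_zero_of_mem_degGE d (k := 1) (by simpa using hμ) one_lt_two
    (mul_mem_degGE_two ha hM)
  rw [mul_sub, mul_one, map_sub] at h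
  exact sub_eq_zero.mp h

theorem IsWeightFunctional.map_mul_right (hψ : IsWeightFunctional ρ μ ψ) (hμ : μ d = 1)
    {a M : Matrix n n 𝒜} (ha : a ∈ degGE 𝒜 (constRep 𝒜 ρ (d : 𝔤)) 1)
    (hM : M - 1 ∈ degGE 𝒜 (constRep 𝒜 ρ (d : 𝔤)) 1) : ψ (M * a) = ψ a := by
  have h := hψ.eq_zero_of_mem_degGE d (k := 1) (by simpa using hμ) one_lt_two
    (mul_mem_degGE_two hM ha)
  rw [sub_mul, one_mul, map_sub] at h
  exact sub_eq_zero.mp h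

end Evaluation

section Vanishing

variable (𝒜 ρ) in
/-- The span of the root vectors on which `d` acts as the identity. -/
def degreeOne (d : H) : Submodule 𝒜 (Matrix n n 𝒜) :=
  Submodule.span 𝒜 {X | ∃ (μ : H → ℂ) (e : 𝔤), μ d = 1 ∧ e ∈ rootSpace H μ ∧
    X = constRep 𝒜 ρ e}

variable {d : H}

theorem degreeOne_le_degGE : degreeOne 𝒜 ρ d ≤ degGE 𝒜 (constRep 𝒜 ρ (d : 𝔤)) 1 := by
  rw [degreeOne, Submodule.span_le]
  rintro _ ⟨μ, e, hμ, he, rfl⟩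
  exact constRep_mem_degGE he (k := 1) (by simpa using hμ) le_rfl

/-- Brackets of root vectors stay in root spaces and degrees add. Thus conjugation leaves the
degree-one part inside the Lie algebra, not merely in the matrix algebra. -/
theorem smul_lie_mem_degreeOne {α : H → ℂ} {e : 𝔤} (he : e ∈ rootSpace H α) (hα : α d = 0)
    (x : 𝒜) {y : Matrix n n 𝒜} (hy : y ∈ degreeOne 𝒜 ρ d) :
    (x • constRep 𝒜 ρ e) * y - y * (x • constRep 𝒜 ρ e) ∈ degreeOne 𝒜 ρ d := by
  rw [smul_mul_assoc, mul_smul_comm, ← smul_sub]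
  refine Submodule.smul_mem _ _ ?_
  have hle : degreeOne 𝒜 ρ d ≤ (degreeOne 𝒜 ρ d).comap
      (LinearMap.mulLeft 𝒜 (constRep 𝒜 ρ e) - LinearMap.mulRight 𝒜 (constRep 𝒜 ρ e)) := by
    conv_lhs => rw [degreeOne]
    rw [Submodule.span_le]
    rintro _ ⟨μ, e', hμ, he', rfl⟩
    refine Submodule.subset_span ⟨α + μ, ⁅e, e'⁆, by simp [hα, hμ], ?_, ?_⟩
    · exact lie_mem_genWeightSpace_of_mem_genWeightSpace he he'
    · rw [constRep_lie]; rfl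
  exact hle hy

/-- Degree excludes `1` and everything of degree at least two. What remains lies in root spaces, and
none has weight `μ`. -/
theorem IsWeightFunctional.map_unipotentMod (hψ : IsWeightFunctional ρ μ ψ) (hμ : μ d = 1)
    (hbot : rootSpace H (μ : H → ℂ) = ⊥) {X : Matrix n n 𝒜}
    (hX : X ∈ unipotentMod (degreeOne 𝒜 ρ d) (constRep 𝒜 ρ (d : 𝔤))) : ψ X = 0 := by
  have hle : degreeOne 𝒜 ρ d ⊔ degGE 𝒜 (constRep 𝒜 ρ (d : 𝔤)) 2 ≤ LinearMap.ker ψ := by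
    refine sup_le ?_ fun Z hZ =>
      hψ.eq_zero_of_mem_degGE d (k := 1) (by simpa using hμ) one_lt_two hZ
    rw [degreeOne, Submodule.span_le]
    rintro _ ⟨ν, e, -, he, rfl⟩
    by_cases h : (μ : H → ℂ) = ν
    · rw [← h, hbot, LieSubmodule.mem_bot] at he
      simp [he]
    · exact hψ.eq_zero_of_mem_rootSpace h he
  have h : ψ (X - 1) = 0 := hle hX
  rwa [map_sub, hψ.map_one hμ, sub_zero] at h

theorem nilExp_mem_unipotentMod {α : H → ℂ} (hα : α ≠ 0) {e : 𝔤} (he : e ∈ rootSpace H α)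
    {m : ℕ} (hm : 1 ≤ m) (hαm : α d = m) (x : 𝒜) :
    nilExp (x • constRep 𝒜 ρ e) ∈ unipotentMod (degreeOne 𝒜 ρ d) (constRep 𝒜 ρ (d : 𝔤)) := by
  have hn := isNilpotent_smul_constRep (𝒜 := 𝒜) ρ hα he x
  have hdeg : x • constRep 𝒜 ρ e ∈ degGE 𝒜 (constRep 𝒜 ρ (d : 𝔤)) m :=
    Submodule.smul_mem _ _ (constRep_mem_degGE he hαm le_rfl)
  rcases hm.eq_or_lt with rfl | hm
  · have h1 := nilExp_sub_one_sub_mem_degGE hn hdeg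
    have h2 : x • constRep 𝒜 ρ e ∈ degreeOne 𝒜 ρ d :=
      Submodule.smul_mem _ _ (Submodule.subset_span ⟨α, e, by simpa using hαm, he, rfl⟩)
    have := Submodule.add_mem_sup h2 h1
    rwa [add_sub_cancel] at this
  · exact Submodule.mem_sup_right (nilExp_sub_one_mem_degGE hn (degGE_anti hm hdeg))

/-- The split is by index rather than by value, since different indices may give equal factors. -/
theorem exists_ofFn_eq_append {B : Type*} (f : Fin N → B) (p : Fin N) :
    ∃ l₁ l₂ : List B, List.ofFn f = l₁ ++ f p :: l₂ ∧
      (∀ X ∈ l₁, ∃ k, k ≠ p ∧ X = f k) ∧ ∀ X ∈ l₂, ∃ k, k ≠ p ∧ X = f k := by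
  obtain ⟨s, t, hst⟩ := List.append_of_mem (List.mem_finRange p)
  have hnd : (s ++ p :: t).Nodup := hst ▸ List.nodup_finRange N
  rw [List.nodup_append] at hnd
  obtain ⟨-, hpt, hs⟩ := hnd
  rw [List.nodup_cons] at hpt
  refine ⟨s.map f, t.map f, ?_, ?_, ?_⟩
  · rw [List.ofFn_eq_map, hst, List.map_append, List.map_cons]
  · intro X hX
    obtain ⟨k, hk, rfl⟩ := List.mem_map.mp hX
    exact ⟨k, hs k hk p List.mem_cons_self, rfl⟩
  · intro X hX
    obtain ⟨k, hk, rfl⟩ := List.mem_map.mp hX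
    exact ⟨k, fun h => hpt.1 (h ▸ hk), rfl⟩

end Vanishing

variable (δ E ρ) in
/-- The ordered product of the exponentials `exp (x_k E_{δ k})`. -/
noncomputable def expProd (x : Fin N → 𝒜) : Matrix n n 𝒜 :=
  (List.ofFn fun k => nilExp (x k • constRep 𝒜 ρ (E (δ k)))).prod

section Factor

variable {d : H} (x : Fin N → 𝒜) (p : Fin N) (hmem : ∀ k, δ k ∈ H.root) (hE : IsCartanWeyl E)
  (hd : ∀ k, k ≠ p → ∃ m : ℕ, 1 ≤ m ∧ δ k d = m) (hdp : δ p d = 0)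
include hmem hE hd hdp

/-- With `M = L₁ u L₂` and `u = exp (x_p E_{δ p})` of degree zero, `u⁻¹ M = (u⁻¹ L₁ u) L₂` and `M
u⁻¹ = L₁ (u L₂ u⁻¹)`. All factors other than `u` have positive degree. -/
theorem factor_mem_unipotentMod :
    nilExp (-(x p • constRep 𝒜 ρ (E (δ p)))) * expProd δ E ρ x ∈
        unipotentMod (degreeOne 𝒜 ρ d) (constRep 𝒜 ρ (d : 𝔤)) ∧
      expProd δ E ρ x * nilExp (-(x p • constRep 𝒜 ρ (E (δ p)))) ∈
        unipotentMod (degreeOne 𝒜 ρ d) (constRep 𝒜 ρ (d : 𝔤)) := by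
  obtain ⟨l₁, l₂, hl, h1, h2⟩ :=
    exists_ofFn_eq_append (fun k => nilExp (x k • constRep 𝒜 ρ (E (δ k)))) p
  have hne : ∀ k, (δ k : H → ℂ) ≠ 0 := fun k => isNonZero_of_mem_root (hmem k)
  have hmul := fun {X Z : Matrix n n 𝒜} => mul_mem_unipotentMod (X := X) (Z := Z)
    (degreeOne_le_degGE (𝒜 := 𝒜) (ρ := ρ) (d := d))
  have hk : ∀ k, k ≠ p → nilExp (x k • constRep 𝒜 ρ (E (δ k))) ∈
      unipotentMod (degreeOne 𝒜 ρ d) (constRep 𝒜 ρ (d : 𝔤)) := fun k hk => by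
    obtain ⟨m, hm, e⟩ := hd k hk
    exact nilExp_mem_unipotentMod (hne k) (hE.mem _ (hmem k)) hm e _
  have hl₁ : l₁.prod ∈ unipotentMod (degreeOne 𝒜 ρ d) (constRep 𝒜 ρ (d : 𝔤)) :=
    prod_mem_unipotentMod degreeOne_le_degGE _ fun X hX => by
      obtain ⟨k, hkp, rfl⟩ := h1 X hX
      exact hk k hkp
  have hl₂ : l₂.prod ∈ unipotentMod (degreeOne 𝒜 ρ d) (constRep 𝒜 ρ (d : 𝔤)) :=
    prod_mem_unipotentMod degreeOne_le_degGE _ fun X hX => by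
      obtain ⟨k, hkp, rfl⟩ := h2 X hX
      exact hk k hkp
  have hep := hE.mem _ (hmem p)
  set a := x p • constRep 𝒜 ρ (E (δ p)) with ha
  have hn : IsNilpotent a := isNilpotent_smul_constRep ρ (hne p) hep (x p)
  have hdeg : a ∈ degGE 𝒜 (constRep 𝒜 ρ (d : 𝔤)) 0 :=
    Submodule.smul_mem _ _ (constRep_mem_degGE hep (k := 0) (by simpa using hdp) le_rfl)
  have hYa : ∀ y ∈ degreeOne 𝒜 ρ d, a * y - y * a ∈ degreeOne 𝒜 ρ d := fun y hy =>
    smul_lie_mem_degreeOne hep hdp _ hy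
  have hYa' : ∀ y ∈ degreeOne 𝒜 ρ d, -a * y - y * -a ∈ degreeOne 𝒜 ρ d := fun y hy => by
    have : -a * y - y * -a = -(a * y - y * a) := by noncomm_ring
    rw [this]
    exact neg_mem (hYa y hy)
  have hM : expProd δ E ρ x = l₁.prod * (nilExp a * l₂.prod) := by
    rw [expProd, hl, List.prod_append, List.prod_cons]
  rw [hM]
  constructor
  · have := hmul (conj_mem_unipotentMod hn.neg (neg_mem hdeg) hYa' hl₁) hl₂
    rwa [neg_neg, mul_assoc, mul_assoc] at this
  · have := hmul hl₁ (conj_mem_unipotentMod hn hdeg hYa hl₂)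
    rwa [← mul_assoc] at this

end Factor

/-- The iterated deformed brackets of two coordinates of an ordered product of exponentials vanish
at the end of a root string. -/
theorem nested_eq_zero_of_bracketRelation (hδ : IsHalfSystem δ) (hE : IsCartanWeyl E)
    (hK : ∀ a a' : ι, killingForm ℂ 𝔤 (K a) (K a') = if a = a' then 1 else 0)
    (hρ : Function.Injective ρ) (P : PoissonBracket 𝒜) {γ c : ℂ} (x : Fin N → 𝒜)
    {p q : Fin N} (hpq : p ≠ q) {d : H} (hd : ∀ k, ∃ m : ℕ, 1 ≤ m ∧ δ k d = m)
    (hdp : δ p d = 1) (hdq : δ q d = 1) {d' : H}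
    (hd' : ∀ k, k ≠ p → ∃ m : ℕ, 1 ≤ m ∧ δ k d' = m) (hdp' : δ p d' = 0) (hdq' : δ q d' = 1)
    {r : ℕ} (hr : rootSpace H
      (((δ q).toLinear : Dual ℂ H) + r • ((δ p).toLinear : Dual ℂ H) : Dual ℂ H) = ⊥)
    (hrel : BracketRelation P γ 1 (halfR δ E ρ c) (hTensor c K ρ) (expProd δ E ρ x)) :
    nestedRight P (c * γ) ((δ p).toLinear : Dual ℂ H) (δ q).toLinear (x p) (x q) r = 0 ∧
      nestedLeft P (c * γ) ((δ p).toLinear : Dual ℂ H) (δ q).toLinear (x p) (x q) r = 0 := by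
  have hmem := hδ.mem
  have hne : ∀ k, (δ k : H → ℂ) ≠ 0 := fun k => isNonZero_of_mem_root (hmem k)
  have hev : ∀ k, E (δ k) ∈ rootSpace H (δ k) := fun k => hE.mem _ (hmem k)
  have hfv : ∀ k, E (-δ k) ∈ rootSpace H (-(δ k : H → ℂ)) := fun k => by
    simpa only [Weight.coe_neg] using hE.mem _ (neg_mem_root (hmem k))
  set a : Fin N → Matrix n n 𝒜 := fun k => x k • constRep 𝒜 ρ (E (δ k)) with ha
  have hnil : ∀ k, IsNilpotent (a k) := fun k => isNilpotent_smul_constRep ρ (hne k) (hev k) _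
  have hedeg : ∀ k, constRep 𝒜 ρ (E (δ k)) ∈ degGE 𝒜 (constRep 𝒜 ρ (d : 𝔤)) 1 := fun k => by
    obtain ⟨m, hm, e⟩ := hd k
    exact constRep_mem_degGE (hev k) e hm
  have hadeg : ∀ k, a k ∈ degGE 𝒜 (constRep 𝒜 ρ (d : 𝔤)) 1 := fun k =>
    Submodule.smul_mem _ _ (hedeg k)
  have hlist : ∀ b ∈ List.ofFn a, IsNilpotent b ∧ b ∈ degGE 𝒜 (constRep 𝒜 ρ (d : 𝔤)) 1 := by
    intro b hb
    obtain ⟨k, rfl⟩ := (List.mem_ofFn' _ _).mp hb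
    exact ⟨hnil k, hadeg k⟩
  have hneg : IsNilpotent (-a p) ∧ -a p ∈ degGE 𝒜 (constRep 𝒜 ρ (d : 𝔤)) 1 :=
    ⟨(hnil p).neg, neg_mem (hadeg p)⟩
  have hM : expProd δ E ρ x = ((List.ofFn a).map nilExp).prod := by
    rw [List.map_ofFn]; rfl
  set M := expProd δ E ρ x with hMdef
  have hM1 : M - 1 ∈ degGE 𝒜 (constRep 𝒜 ρ (d : 𝔤)) 1 := by
    rw [hM]; exact prod_nilExp_sub_one_mem _ hlist
  -- The witness is `E_{-δ k}` divided by a trace. It kills the other root vectors by weight.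
  have hG : ∀ k : Fin N, ∃ G : Matrix n n ℂ,
      IsWeightFunctional ρ ((δ k).toLinear : Dual ℂ H) (traceWith (𝒜 := 𝒜) G) ∧
      ∀ m, traceWith G (constRep 𝒜 ρ (E (δ m))) = if m = k then 1 else 0 := fun k => by
    have ht := trace_mul_ne_zero ρ hρ (isNonZero_of_mem_root (hmem k)) (hev k) (hfv k)
      (hE.killing_neg _ (hmem k))
    have hw : IsWeightFunctional ρ ((δ k).toLinear : Dual ℂ H)
        (traceWith (𝒜 := 𝒜) (((ρ (E (δ k)) * ρ (E (-δ k))).trace)⁻¹ • ρ (E (-δ k)))) :=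
      isWeightFunctional_traceWith (by simp) (hfv k) _
    refine ⟨_, hw, fun m => ?_⟩
    split_ifs with h
    · subst h
      rw [traceWith_apply, constRep_apply, ← const_mul, smul_mul_assoc]
      rw [Matrix.trace_mul_comm] at ht
      have : ∀ Z : Matrix n n ℂ, (const 𝒜 Z).trace = algebraMap ℂ 𝒜 Z.trace := fun Z => by
        simp [Matrix.trace, const]
      rw [this, Matrix.trace_smul, Matrix.trace_mul_comm (ρ (E (δ m))), smul_eq_mul,
        inv_mul_cancel₀ ht, map_one]
    · refine hw.eq_zero_of_mem_rootSpace (fun h' => h (hδ.injective ?_)) (hev m)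
      exact DFunLike.coe_injective (by simpa using h'.symm)
  obtain ⟨G, hGw, hGe⟩ := hG p
  obtain ⟨G', hGw', hGe'⟩ := hG q
  have hμp : ((δ p).toLinear : Dual ℂ H) d = 1 := hdp
  have hμq : ((δ q).toLinear : Dual ℂ H) d = 1 := hdq
  have hsum : ∀ (G : Matrix n n ℂ) (k : Fin N),
      (∀ m, traceWith G (constRep 𝒜 ρ (E (δ m))) = if m = k then 1 else 0) →
      traceWith G (List.ofFn a).sum = x k := fun G k h => by
    rw [List.sum_ofFn, map_sum]
    simp [ha, h]
  have hGM : traceWith G M = x p := by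
    rw [hM, hGw.map_prod_nilExp hμp _ hlist, hsum G p hGe]
  have hDM := map_bracket_of_bracketRelation (P := P) hrel
    (commute_prod_kronecker _ fun X hX => by
      obtain ⟨k, rfl⟩ := (List.mem_ofFn' _ _).mp hX
      exact commute_nilExp_kronecker (hnil k) (commute_casimir_leg hδ hE hK _ _))
    hK hGw
    (fun k => by rw [hGw.map_mul_left hμp (hedeg k) hM1, hGe])
    (fun k => by rw [hGw.map_mul_right hμp (hedeg k) hM1, hGe])
  rw [hGM] at hDM
  set h : H := (cartanEquivDual H).symm (δ p).toLinear with hh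
  have hef : constRep 𝒜 ρ (E (δ p)) * constRep 𝒜 ρ (E (-δ p)) -
      constRep 𝒜 ρ (E (-δ p)) * constRep 𝒜 ρ (E (δ p)) = constRep 𝒜 ρ (h : 𝔤) := by
    rw [← constRep_lie, lie_eq_killingForm_smul_of_mem_rootSpace_of_mem_rootSpace_neg (hev p)
      (hfv p), hE.killing_neg _ (hmem p), one_smul]
  have hhe := constRep_lie_of_mem_rootSpace (𝒜 := 𝒜) (ρ := ρ) (hev p) h
  -- Because `{x_p, x_p} = 0`, the cancelling factor is constant for the derivation `{x_p, ·}`.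
  have hv0 : (nilExp (-a p)).map (P.bracket (x p)) = 0 :=
    nilExp_mem (hnil p).neg (neg_mem (smul_const_mem_centralizer P (x p) _))
  have hconst : IsConstant P (traceWith (𝒜 := 𝒜) G') := traceWith_map_bracket P G'
  obtain ⟨hU, hU'⟩ := factor_mem_unipotentMod (ρ := ρ) x p hmem hE hd' hdp'
  have hfL : E (-δ p) ∈ rootSpace H (-((δ p).toLinear : Dual ℂ H) : H → ℂ) := by
    rw [Weight.coe_coe]; exact hfv p
  have hμr : (((δ q).toLinear : Dual ℂ H) + r • ((δ p).toLinear : Dual ℂ H) : Dual ℂ H) d' = 1 := by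
    rw [LinearMap.add_apply, LinearMap.smul_apply, Weight.toLinear_apply, Weight.toLinear_apply,
      hdp', hdq', smul_zero, add_zero]
  have hzero : ∀ X ∈ unipotentMod (degreeOne 𝒜 ρ d') (constRep 𝒜 ρ (d' : 𝔤)),
      (adFunctional ρ (E (-δ p)))^[r] (traceWith G') X = 0 := fun X hX =>
    (hGw'.iterate_adFunctional hfL r).map_unipotentMod hμr hr hX
  constructor
  · have hval : traceWith G' (M * nilExp (-a p)) = x q := by
      -- The cancelling factor is just one more exponential in the list. It adds a multiple of `E_{δ
      -- p}` in degree one, which the functional dual to `E_{δ q}` does not see.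
      have : M * nilExp (-a p) = ((List.ofFn a ++ [-a p]).map nilExp).prod := by
        rw [hM]; simp
      rw [this, hGw'.map_prod_nilExp hμq, List.sum_append, map_add, hsum G' q hGe']
      · simp [ha, hGe', hpq]
      · intro b hb
        rcases List.mem_append.mp hb with hb | hb
        · exact hlist b hb
        · rw [List.mem_singleton.mp hb]; exact hneg
    rw [← hval, nestedRight_eq hconst hGw' hfL (κ := c * γ) (x := x p), hzero _ hU', smul_zero]
    rw [map_bracket_mul, hv0, mul_zero, add_zero, hDM, smul_mul_assoc,
      linearise_right hef hhe (x p) (hnil p)]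
  · have hval : traceWith G' (nilExp (-a p) * M) = x q := by
      have : nilExp (-a p) * M = ((-a p :: List.ofFn a).map nilExp).prod := by
        rw [hM]; simp
      rw [this, hGw'.map_prod_nilExp hμq, List.sum_cons, map_add, hsum G' q hGe']
      · simp [ha, hGe', hpq]
      · intro b hb
        rcases List.mem_cons.mp hb with hb | hb
        · rw [hb]; exact hneg
        · exact hlist b hb
    rw [← hval, nestedLeft_eq hconst hGw' hfL (κ := c * γ) (x := x p), hzero _ hU, smul_zero]
    rw [map_bracket_mul, hv0, zero_mul, zero_add, hDM, mul_smul_comm,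
      linearise_left hef hhe (x p) (hnil p)]

end Core

/-! ### Gradings from simple roots, half systems and the end of the root string. -/

section Roots

variable {𝔤 : Type*} [LieRing 𝔤] [LieAlgebra ℂ 𝔤] [FiniteDimensional ℂ 𝔤] [IsSemisimple ℂ 𝔤]
variable {H : LieSubalgebra ℂ 𝔤} [H.IsCartanSubalgebra] {b : (rootSystem H).Base}

theorem exists_cartan_apply_eq (g : H.root → ℂ) :
    ∃ d : H, ∀ i ∈ b.support, i.1 d = g i := by
  let L : Dual ℂ (Dual ℂ H) := b.toWeightBasis.constr ℂ fun i => g i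
  refine ⟨(evalEquiv ℂ H).symm L, fun i hi => ?_⟩
  have h1 : L (i.1.toLinear : Dual ℂ H) = g i := by
    have h := b.toWeightBasis.constr_basis ℂ (fun i => g i) ⟨i, hi⟩
    rwa [RootPairing.Base.toWeightBasis_apply, rootSystem_root_apply] at h
  rw [← h1, ← Weight.toLinear_apply, apply_evalEquiv_symm_apply]

theorem exists_root_eq_sum_nat_of_isPos {k : H.root} (hk : b.IsPos k) :
    ∃ f : H.root → ℕ, (rootSystem H).root k = ∑ j ∈ b.support, f j • (rootSystem H).root j := by
  obtain ⟨f, -, hf | hf⟩ := b.exists_root_eq_sum_nat_or_neg k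
  · exact ⟨f, hf⟩
  · have h1 : (rootSystem H).root k =
        ∑ j ∈ b.support, (fun j => -(f j : ℤ)) j • (rootSystem H).root j := by
      rw [hf, ← Finset.sum_neg_distrib]
      simp
    have h2 := RootPairing.Base.height_eq_sum h1
    have h3 : ∑ j ∈ b.support, -(f j : ℤ) ≤ 0 := Finset.sum_nonpos fun j _ => by simp
    have h4 := b.isPos_iff.mp hk
    rw [h2] at h4
    exact absurd h4 (not_lt.mpr h3)

theorem root_apply_eq_sum {k : H.root} {f : H.root → ℕ}
    (hf : (rootSystem H).root k = ∑ j ∈ b.support, f j • (rootSystem H).root j) (d : H) :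
    k.1 d = ∑ j ∈ b.support, (f j : ℂ) * j.1 d := by
  have := congrArg (fun φ : Dual ℂ H => φ d) hf
  simpa using this

/-- The element of the Cartan subalgebra which takes the value `1` at all simple roots. -/
theorem exists_height_cartan (b : (rootSystem H).Base) :
    ∃ d : H, (∀ i ∈ b.support, i.1 d = 1) ∧ ∀ k, b.IsPos k → ∃ m : ℕ, 1 ≤ m ∧ k.1 d = m := by
  obtain ⟨d, hd⟩ := exists_cartan_apply_eq (b := b) fun _ => 1
  refine ⟨d, hd, fun k hk => ?_⟩
  obtain ⟨f, hf⟩ := exists_root_eq_sum_nat_of_isPos hk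
  refine ⟨∑ j ∈ b.support, f j, ?_, ?_⟩
  · have h1 : (rootSystem H).root k =
        ∑ j ∈ b.support, (fun j => (f j : ℤ)) j • (rootSystem H).root j := by
      rw [hf]; simp
    have h2 := b.isPos_iff.mp hk
    rw [RootPairing.Base.height_eq_sum h1] at h2
    exact_mod_cast h2
  · rw [root_apply_eq_sum hf]
    push_cast
    exact Finset.sum_congr rfl fun j hj => by rw [hd j hj, mul_one]

/-- The element of the Cartan subalgebra which takes the value `0` at one simple root and `1` at
all others. -/
theorem exists_coheight_cartan {i : H.root} (hi : i ∈ b.support) :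
    ∃ d : H, i.1 d = 0 ∧ (∀ j ∈ b.support, j ≠ i → j.1 d = 1) ∧
      ∀ k, b.IsPos k → k ≠ i → ∃ m : ℕ, 1 ≤ m ∧ k.1 d = m := by
  classical
  obtain ⟨d, hd⟩ := exists_cartan_apply_eq (b := b) fun j => if j = i then 0 else 1
  refine ⟨d, by simpa using hd i hi, fun j hj hji => by simpa [hji] using hd j hj,
    fun k hk hki => ?_⟩
  obtain ⟨f, hf⟩ := exists_root_eq_sum_nat_of_isPos hk
  refine ⟨∑ j ∈ b.support.erase i, f j, ?_, ?_⟩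
  -- Otherwise the root is a multiple of the simple root `i`. The multiple must be `±1`, and a
  -- natural coefficient leaves only `1`, contradicting `k ≠ i`.
  · by_contra h0
    have h1 : ∀ j ∈ b.support.erase i, f j = 0 :=
      Finset.sum_eq_zero_iff.mp (by omega)
    have h2 : (rootSystem H).root k = (f i : ℂ) • (rootSystem H).root i := by
      rw [hf, ← Finset.add_sum_erase _ _ hi, Finset.sum_eq_zero, add_zero, Nat.cast_smul_eq_nsmul]
      intro j hj
      rw [h1 j hj, zero_smul]
    have h3 : (f i : ℂ) = 1 := by
      have : IsAddTorsionFree H := .of_isTorsionFree ℂ H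
      have : IsAddTorsionFree (Dual ℂ H) := .of_isTorsionFree ℂ _
      rcases b.eq_one_or_neg_one_of_mem_support_of_smul_mem i hi (f i : ℂ) ⟨k, h2⟩ with h | h
      · exact h
      · exfalso
        have : ((f i : ℤ) : ℂ) = ((-1 : ℤ) : ℂ) := by push_cast; exact h
        have := Int.cast_injective this
        omega
    rw [h3, one_smul] at h2
    exact hki ((rootSystem H).root.injective h2)
  · rw [root_apply_eq_sum hf, ← Finset.add_sum_erase _ _ hi, hd i hi]
    push_cast
    rw [if_pos rfl, mul_zero, zero_add]
    refine Finset.sum_congr rfl fun j hj => ?_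
    rw [hd j (Finset.mem_of_mem_erase hj), if_neg (Finset.ne_of_mem_erase hj), mul_one]

theorem isHalfSystem_root {N : ℕ} (β : PosLabelling b N) : IsHalfSystem β.root where
  mem k := (β k).1.2
  injective k m h := β.injective (Subtype.ext (Subtype.ext h))
  ne_neg k m h := by
    obtain ⟨d, -, hd⟩ := exists_height_cartan b
    obtain ⟨r, hr, er⟩ := hd _ (β k).2
    obtain ⟨s, hs, es⟩ := hd _ (β m).2
    have h1 : (β k).1.1 d = -(β m).1.1 d := by
      have := congrArg (fun χ : Weight ℂ H 𝔤 => χ d) h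
      simpa [PosLabelling.root] using this
    rw [er, es] at h1
    have h2 : ((r + s : ℕ) : ℂ) = 0 := by push_cast; rw [h1]; ring
    have : r + s = 0 := by exact_mod_cast h2
    omega
  exhaust α hα := by
    obtain ⟨f, -, hf | hf⟩ := b.exists_root_eq_sum_nat_or_neg ⟨α, hα⟩
    · have hpos : b.IsPos ⟨α, hα⟩ := by
        rw [b.isPos_iff', RootPairing.Base.height_eq_sum (f := fun j => (f j : ℤ))
          (by rw [hf]; simp)]
        positivity
      exact ⟨β.symm ⟨⟨α, hα⟩, hpos⟩, Or.inl (by simp [PosLabelling.root])⟩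
    · have hα' := neg_mem_root hα
      have hpos : b.IsPos ⟨-α, hα'⟩ := by
        have h1 : (rootSystem H).root ⟨-α, hα'⟩ = -(rootSystem H).root ⟨α, hα⟩ := by simp
        rw [b.isPos_iff', RootPairing.Base.height_eq_sum (f := fun j => (f j : ℤ))
          (by rw [h1, hf]; simp)]
        positivity
      exact ⟨β.symm ⟨⟨-α, hα'⟩, hpos⟩, Or.inr (by simp [PosLabelling.root])⟩

theorem IsHalfSystem.neg {N : ℕ} {δ : Fin N → Weight ℂ H 𝔤} (hδ : IsHalfSystem δ) :
    IsHalfSystem fun k => -δ k where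
  mem k := neg_mem_root (hδ.mem k)
  injective k m h := hδ.injective (by simpa using h)
  ne_neg k m h := hδ.ne_neg m k (by simpa using h.symm)
  exhaust α hα := by
    obtain ⟨k, h | h⟩ := hδ.exhaust α hα
    · exact ⟨k, Or.inr (by simpa using h)⟩
    · exact ⟨k, Or.inl h⟩

/-- The difference of two simple roots is not a root, so the `i`-string through `j` extends upwards
exactly `-A_ij` steps. The depth `1 - A_ij` is one step beyond. -/
theorem rootSpace_serreDepth {i j : H.root} (hi : i ∈ b.support) (hj : j ∈ b.support)
    (hij : i ≠ j) : rootSpace H ((j.1.toLinear : Dual ℂ H) +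
      serreDepth i j • (i.1.toLinear : Dual ℂ H) : Dual ℂ H) = ⊥ := by
  by_contra hne
  let χ : Weight ℂ H 𝔤 := ⟨_, hne⟩
  have hχ : (χ.toLinear : Dual ℂ H) =
      (j.1.toLinear : Dual ℂ H) + serreDepth i j • (i.1.toLinear : Dual ℂ H) := by
    ext; rfl
  have hnz : χ ∈ H.root := by
    have : χ.IsNonZero := fun h0 => by
      obtain ⟨d, hd, -⟩ := exists_height_cartan b
      have h1 : (χ.toLinear : Dual ℂ H) d = 0 := congrFun h0.eq d
      rw [hχ, LinearMap.add_apply, LinearMap.smul_apply, Weight.toLinear_apply,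
        Weight.toLinear_apply, hd i hi, hd j hj] at h1
      have h2 : ((1 + serreDepth i j : ℕ) : ℂ) = 0 := by
        push_cast
        simpa using h1
      have : 1 + serreDepth i j = 0 := by exact_mod_cast h2
      omega
    simpa using this
  have hij' : (⟨i, hi⟩ : b.support) ≠ ⟨j, hj⟩ := by simpa using hij
  have hlin := b.linearIndependent_pair_of_ne hij'
  have htop : ((rootSystem H).chainTopCoeff i j : ℤ) = -(rootSystem H).pairingIn ℤ j i :=
    b.chainTopCoeff_eq_of_ne (i := ⟨i, hi⟩) (j := ⟨j, hj⟩) hij'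
  have hmem : (rootSystem H).root j + serreDepth i j • (rootSystem H).root i ∈
      Set.range (rootSystem H).root := ⟨⟨χ, hnz⟩, by simpa using hχ⟩
  have hle : serreDepth i j ≤ (rootSystem H).chainTopCoeff i j := (RootPairing.root_add_nsmul_mem_range_iff_le_chainTopCoeff hlin).mp hmem
  unfold serreDepth at hle
  omega

theorem rootSpace_neg_eq_bot {μ : Dual ℂ H} (h : rootSpace H (μ : H → ℂ) = ⊥) :
    rootSpace H ((-μ : Dual ℂ H) : H → ℂ) = ⊥ := by
  by_contra hne
  let χ : Weight ℂ H 𝔤 := ⟨_, hne⟩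
  have h1 : ((-χ : Weight ℂ H 𝔤) : H → ℂ) = μ := by
    rw [Weight.coe_neg]
    ext x
    change -(-μ) x = μ x
    simp
  have h2 := (-χ).genWeightSpace_ne_bot
  rw [h1] at h2
  exact h2 h

end Roots

/-! ### Homogeneity of the deformed brackets and the change of sign. -/

section Scaling

variable {𝔤 : Type*} [LieRing 𝔤] [LieAlgebra ℂ 𝔤] [FiniteDimensional ℂ 𝔤] [IsSemisimple ℂ 𝔤]
variable {H : LieSubalgebra ℂ 𝔤} [H.IsCartanSubalgebra]
variable {𝒜 : Type*} [CommRing 𝒜] [Algebra ℂ 𝒜] (P : PoissonBracket 𝒜)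

theorem qBracket_smul (t : ℂ) (μ ν : Dual ℂ H) (x y : ℂ) (f g : 𝒜) :
    qBracket P t μ ν (x • f) (y • g) = (x * y) • qBracket P t μ ν f g := by
  simp only [qBracket, map_smul, LinearMap.smul_apply, smul_mul_smul_comm, smul_add, smul_smul]
  rw [mul_comm y x, mul_comm (x * y)]

theorem nestedRight_smul (t : ℂ) (μ ν : Dual ℂ H) (x y : ℂ) (f g : 𝒜) (r : ℕ) :
    nestedRight P t μ ν (x • f) (y • g) r = (y * x ^ r) • nestedRight P t μ ν f g r := by
  induction r with
  | zero => simp [nestedRight]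
  | succ r ih => rw [nestedRight, ih, qBracket_smul, nestedRight, pow_succ, mul_assoc]

theorem nestedLeft_smul (t : ℂ) (μ ν : Dual ℂ H) (x y : ℂ) (f g : 𝒜) (r : ℕ) :
    nestedLeft P t μ ν (x • f) (y • g) r = (y * x ^ r) • nestedLeft P t μ ν f g r := by
  induction r with
  | zero => simp [nestedLeft]
  | succ r ih =>
    rw [nestedLeft, ih, qBracket_smul, nestedLeft, pow_succ']
    congr 1
    ring

/-- Exchanging positive and negative roots negates `R₁₂` but not `H₁₂`, so a sign absorbed in `γ`
reduces the lower-sign relation to the upper-sign one. -/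
theorem BracketRelation.neg {n : Type*} [Fintype n] [DecidableEq n] {P : PoissonBracket 𝒜} {γ : ℂ}
    {R₁₂ H₁₂ : Matrix (n × n) (n × n) ℂ} {M : Matrix n n 𝒜}
    (h : BracketRelation P γ (-1) R₁₂ H₁₂ M) : BracketRelation P (-γ) 1 (-R₁₂) H₁₂ M := by
  have hR : const 𝒜 (-R₁₂) = -const 𝒜 R₁₂ := by
    ext; simp [const]
  rw [BracketRelation] at h ⊢
  rw [h, hR]
  simp only [neg_smul, one_smul, ← smul_neg]
  congr 1
  simp only [neg_mul, mul_neg]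
  abel

end Scaling

end QPoissonSerre

/-! ### The Serre relations for both signs. -/

theorem mainTheorem5
    {𝔤 : Type*} [LieRing 𝔤] [LieAlgebra ℂ 𝔤] [FiniteDimensional ℂ 𝔤] [IsSemisimple ℂ 𝔤]
    (H : LieSubalgebra ℂ 𝔤) [H.IsCartanSubalgebra] (b : (rootSystem H).Base)
    (E : Weight ℂ H 𝔤 → 𝔤) (hE : QPoissonSerre.IsCartanWeyl E)
    {ι : Type*} [Fintype ι] [DecidableEq ι] (K : Basis ι ℂ H)
    (hK : ∀ a a' : ι, killingForm ℂ 𝔤 (K a) (K a') = if a = a' then 1 else 0)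
    {N : ℕ} (β : QPoissonSerre.PosLabelling b N) (hβ : β.IsConvex)
    (c : ℂ) (hc : c = 1 ∨ c = Complex.I) (γ : ℝ) (hγ : γ ≠ 0)
    (A : Weight ℂ H 𝔤 → ℂ) (hA : ∀ α ∈ H.root, A α ≠ 0)
    {n : Type*} [Fintype n] [DecidableEq n]
    (ρ : 𝔤 →ₗ⁅ℂ⁆ Matrix n n ℂ) (hρ : Function.Injective ρ)
    {𝒜 : Type*} [CommRing 𝒜] [Algebra ℂ 𝒜] (P : QPoissonSerre.PoissonBracket 𝒜)
    (Q : Weight ℂ H 𝔤 → 𝒜) :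
    (QPoissonSerre.BracketRelation P γ 1
        (QPoissonSerre.rTensor c E β ρ) (QPoissonSerre.hTensor c K ρ)
        (QPoissonSerre.mPlus c γ E A β ρ Q) →
      ∀ i ∈ b.support, ∀ j ∈ b.support, i ≠ j →
        QPoissonSerre.nestedRight P (c * γ) (i.1.toLinear : Dual ℂ H) j.1.toLinear
            (Q i.1) (Q j.1) (QPoissonSerre.serreDepth i j) = 0 ∧
        QPoissonSerre.nestedLeft P (c * γ) (i.1.toLinear : Dual ℂ H) j.1.toLinear
            (Q i.1) (Q j.1) (QPoissonSerre.serreDepth i j) = 0) ∧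
    (QPoissonSerre.BracketRelation P γ (-1)
        (QPoissonSerre.rTensor c E β ρ) (QPoissonSerre.hTensor c K ρ)
        (QPoissonSerre.mMinus c γ E A β ρ Q) →
      ∀ i ∈ b.support, ∀ j ∈ b.support, i ≠ j →
        QPoissonSerre.nestedRight P (-(c * γ)) (-i.1.toLinear : Dual ℂ H) (-j.1.toLinear)
            (Q (-i.1)) (Q (-j.1)) (QPoissonSerre.serreDepth i j) = 0 ∧
        QPoissonSerre.nestedLeft P (-(c * γ)) (-i.1.toLinear : Dual ℂ H) (-j.1.toLinear)
            (Q (-i.1)) (Q (-j.1)) (QPoissonSerre.serreDepth i j) = 0) := by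
  classical
  have hδ := QPoissonSerre.isHalfSystem_root β
  have hc0 : c ≠ 0 := by
    rcases hc with rfl | rfl
    · exact one_ne_zero
    · exact Complex.I_ne_zero
  have hγ0 : (γ : ℂ) ≠ 0 := by exact_mod_cast hγ
  have hz : ∀ α ∈ H.root, Complex.I * c * γ * A α ≠ 0 := fun α hα =>
    mul_ne_zero (mul_ne_zero (mul_ne_zero Complex.I_ne_zero hc0) hγ0) (hA α hα)
  have hidx : ∀ i (hi : i ∈ b.support),
      β.root (β.symm ⟨i, b.isPos_of_mem_support hi⟩) = i.1 := fun i hi => by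
    simp [QPoissonSerre.PosLabelling.root]
  obtain ⟨d, hd1, hd⟩ := QPoissonSerre.exists_height_cartan b
  constructor
  · intro hrel i hi j hj hij
    obtain ⟨d', hdi, hdj, hd'⟩ := QPoissonSerre.exists_coheight_cartan hi
    set p := β.symm ⟨i, b.isPos_of_mem_support hi⟩ with hp
    set q := β.symm ⟨j, b.isPos_of_mem_support hj⟩ with hq
    have hip : β.root p = i.1 := hidx i hi
    have hjq : β.root q = j.1 := hidx j hj
    have hpq : p ≠ q := fun h => hij (Subtype.ext (by rw [← hip, ← hjq, h]))
    have key := QPoissonSerre.nested_eq_zero_of_bracketRelation (γ := γ) (c := c) hδ hE hK hρ P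
      (fun k => (Complex.I * c * γ * A (β.root k)) • Q (β.root k)) hpq
      (fun k => hd _ (β k).2) (by rw [hip]; exact hd1 i hi) (by rw [hjq]; exact hd1 j hj)
      (fun k hk => hd' _ (β k).2 fun h => hk (β.injective (by
        rw [hp, Equiv.apply_symm_apply]; exact Subtype.ext h)))
      (by rw [hip]; exact hdi) (by rw [hjq]; exact hdj j hj hij.symm)
      (r := QPoissonSerre.serreDepth i j)
      (by rw [hip, hjq]; exact QPoissonSerre.rootSpace_serreDepth hi hj hij) hrel
    -- Homogeneity extracts the normalisation of `j` times the `r`-th power of that of `i`, a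
    -- nonzero scalar.
    simp only [hip, hjq, QPoissonSerre.nestedRight_smul, QPoissonSerre.nestedLeft_smul] at key
    have hne := mul_ne_zero (hz j.1 j.2) (pow_ne_zero (QPoissonSerre.serreDepth i j) (hz i.1 i.2))
    exact ⟨(smul_eq_zero_iff_right hne).mp key.1, (smul_eq_zero_iff_right hne).mp key.2⟩
  · intro hrel i hi j hj hij
    obtain ⟨d', hdi, hdj, hd'⟩ := QPoissonSerre.exists_coheight_cartan hi
    set p := β.symm ⟨i, b.isPos_of_mem_support hi⟩ with hp
    set q := β.symm ⟨j, b.isPos_of_mem_support hj⟩ with hq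
    have hip : β.root p = i.1 := hidx i hi
    have hjq : β.root q = j.1 := hidx j hj
    have hpq : p ≠ q := fun h => hij (Subtype.ext (by rw [← hip, ← hjq, h]))
    have hneg : ∀ (χ : Weight ℂ H 𝔤) (h : H), (-χ) (-h) = χ h := fun χ h => by
      rw [Weight.coe_neg, Pi.neg_apply, ← Weight.toLinear_apply, map_neg, neg_neg,
        Weight.toLinear_apply]
    have hR : QPoissonSerre.halfR (fun k => -β.root k) E ρ c =
        -QPoissonSerre.rTensor c E β ρ := by
      simp only [QPoissonSerre.halfR, QPoissonSerre.rTensor, neg_neg, ← smul_neg,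
        ← Finset.sum_neg_distrib, neg_sub]
    have hrel' : QPoissonSerre.BracketRelation P (-γ) 1
        (QPoissonSerre.halfR (fun k => -β.root k) E ρ c) (QPoissonSerre.hTensor c K ρ)
        (QPoissonSerre.expProd (fun k => -β.root k) E ρ fun k =>
          (-(Complex.I * c * γ * A (-β.root k))) • Q (-β.root k)) := by
      rw [hR]
      exact QPoissonSerre.BracketRelation.neg hrel
    -- Negating the two grading elements makes their values on the roots `-β_k` equal to the former
    -- values on `β_k`.
    have key := QPoissonSerre.nested_eq_zero_of_bracketRelation hδ.neg hE hK hρ P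
      (fun k => (-(Complex.I * c * γ * A (-β.root k))) • Q (-β.root k)) hpq (d := -d)
      (fun k => by rw [hneg]; exact hd _ (β k).2) (by rw [hneg, hip]; exact hd1 i hi)
      (by rw [hneg, hjq]; exact hd1 j hj) (d' := -d')
      (fun k hk => by
        rw [hneg]
        exact hd' _ (β k).2 fun h => hk (β.injective (by
          rw [hp, Equiv.apply_symm_apply]; exact Subtype.ext h)))
      (by rw [hneg, hip]; exact hdi) (by rw [hneg, hjq]; exact hdj j hj hij.symm)
      (r := QPoissonSerre.serreDepth i j)
      (by
        have h := QPoissonSerre.rootSpace_neg_eq_bot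
          (QPoissonSerre.rootSpace_serreDepth hi hj hij)
        rw [neg_add, ← smul_neg] at h
        simpa only [hip, hjq, Weight.toLinear_neg] using h) hrel'
    -- The parameter `c (-γ)` becomes `-(c γ)`: this is where the `q⁻¹`-bracket comes from.
    simp only [hip, hjq, QPoissonSerre.nestedRight_smul, QPoissonSerre.nestedLeft_smul,
      Weight.toLinear_neg, mul_neg] at key
    have hne := mul_ne_zero (neg_ne_zero.mpr (hz _ (QPoissonSerre.neg_mem_root j.2)))
      (pow_ne_zero (QPoissonSerre.serreDepth i j)
        (neg_ne_zero.mpr (hz _ (QPoissonSerre.neg_mem_root i.2))))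
    exact ⟨(smul_eq_zero_iff_right hne).mp key.1, (smul_eq_zero_iff_right hne).mp key.2⟩
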